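/- Let $A(\mathbb R)$ be the set of functions $f:\mathbb R\to\mathbb C$ that can be written as $f(y)=\int_{\mathbb R} g(x)e^{ixy}\,dx$ for all $y\in\mathbb R$, with some $g\in L_1(\mathbb R)$. For $\alpha>0$ and $\beta\in\mathbb R$ let $H_{\alpha,\beta}$ be the class of functions $f:\mathbb R\to\mathbb C$ that are continuous on $\mathbb R$ with $f(t)\to 0$ as $|t|\to\infty$, are locally absolutely continuous on $\mathbb R\setminus\{0\}$, and satisfy $$\int_0^1 \Big(\operatorname*{ess\,sup}_{t\le |s|\le R}|f'(s)|\Big)\ln\frac 2t\,dt<\infty\quad\text{for every } R>0,$$ $$f(t)=O(|t|^{-\alpha}),\qquad f'(t)=O(|t|^{-\beta})\ \text{ for almost every } t,\qquad\text{as } |t|\to\infty .$$ (If $\beta\ge 0$, the integral condition is equivalent to $A_1=\int_0^1 f_1(t)\ln\frac2t\,dt<\infty$, where $f_1(t)=\operatorname*{ess\,sup}_{|s|\ge t}|f'(s)|$.) (i) If $\alpha>0$, $\beta\in\mathbb R$, $\alpha+\beta>1$ and $f\in H_{\alpha,\beta}$, then $f\in A(\mathbb R)$. (ii) If $\alpha>0$,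 $\beta\in\mathbb R$ and $\alpha+\beta<1$, the assertion fails: there are $\alpha_1>0$ and $\beta_1>0$ such that the function $e^{i|t|^{\alpha_1}}/(1+t^2)^{\beta_1}$ belongs to $H_{\alpha,\beta}$ but not to $A(\mathbb R)$. -/

import Mathlib

open MeasureTheory Filter Asymptotics Topology

noncomputable section

/-- `f ∈ A(ℝ)`: `f` is an absolutely convergent Fourier integral,
`f y = ∫ g x e^{ixy} dx` for all real `y`, with some `g ∈ L¹(ℝ)`. -/
def MemFourierA (f : ℝ → ℂ) : Prop :=
  ∃ g : ℝ → ℂ, Integrable g ∧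
    ∀ y : ℝ, f y = ∫ x : ℝ, g x * Complex.exp (Complex.I * ((x * y : ℝ) : ℂ))

/-- `f ∈ C₀(ℝ)`. -/
def IsC0 (f : ℝ → ℂ) : Prop :=
  Continuous f ∧ Tendsto f (cocompact ℝ) (𝓝 0)

/-- `f` is locally absolutely continuous on `ℝ \ {0}`: absolutely continuous on every compact
interval that does not contain `0`. -/
def LocallyACOffZero (f : ℝ → ℂ) : Prop :=
  ∀ a b : ℝ, a ≤ b → (0 : ℝ) ∉ Set.Icc a b → AbsolutelyContinuousOnInterval f a b

/-- The monotone majorant of the derivative, `ess sup_{t ≤ |s| ≤ R} |f'(s)|`. -/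
def derivMajorant (f : ℝ → ℂ) (R t : ℝ) : ENNReal :=
  essSup (fun s : ℝ => ‖deriv f s‖ₑ) (volume.restrict {s : ℝ | t ≤ |s| ∧ |s| ≤ R})

/-- `∫₀¹ (ess sup_{t ≤ |s| ≤ R} |f'(s)|) ln (2 / t) dt`, with values in `[0, ∞]`. -/
def A1 (f : ℝ → ℂ) (R : ℝ) : ENNReal :=
  ∫⁻ t in Set.Ioc (0 : ℝ) 1, derivMajorant f R t * ENNReal.ofReal (Real.log (2 / t))

/-- The hypotheses on `f` for the exponents `α` and `β`. The condition on `A1` is imposed on every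
bounded range of `s`, so that it concerns the behaviour of `f'` near the origin (and its essential
boundedness on compact subsets of `ℝ \ {0}`) and allows `f'` to be unbounded at infinity.
The derivative exists almost everywhere only, and is bounded at infinity up to null sets. -/
structure DecayHypotheses (f : ℝ → ℂ) (α β : ℝ) : Prop where
  isC0 : IsC0 f
  locallyAC : LocallyACOffZero f
  A1_lt_top : ∀ R : ℝ, A1 f R < ⊤
  isBigO : f =O[cocompact ℝ] fun t : ℝ => |t| ^ (-α)
  deriv_isBigO : deriv f =O[cocompact ℝ ⊓ ae volume] fun t : ℝ => |t| ^ (-β)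

/-- `e^{i|t|^{α₁}} / (1 + t²)^{β₁}`. -/
def oscillating (α₁ β₁ t : ℝ) : ℂ :=
  Complex.exp (Complex.I * ((|t| ^ α₁ : ℝ) : ℂ)) / (((1 + t ^ 2) ^ β₁ : ℝ) : ℂ)

end

/-! Positive half. A Lipschitz function of size `S` and slope `D` supported in an interval of length
`L` has `A(ℝ)`-norm at most a constant times `√(L S D)`: by Plancherel its transform is controlled
in `L²` with weight `1 + (lξ)²`, and Cauchy–Schwarz gives `L¹` (`exists_rep_of_lipschitz`).
Subtracting `f 0 * tent` makes `f` vanish at the origin; each half-line is then cut by a dyadic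
partition of unity, and it suffices that `∑ √(S k * E k)` converges, where `E k` is the slope near
`2 ^ k` times `2 ^ k` (`MemFourierA.of_dyadic`). At infinity the terms are of order `2 ^ (k (1 - α -
γ) / 2)` with `γ = min β 1`, which is geometric decay when `α + β > 1`. Near the origin size and
scaled slope are both bounded, up to a geometric term, by the integral of the monotone majorant over
`(0, 2⁻ⁿ]`. A point `s` lies in about `log₂ (2 / s)` of these intervals, so the logarithmic weight
is what makes the sum over `n` finite.

Negative half. If the oscillating function had an integrable representing `g`, multiplying by `e^{-i
t^a}` and integrating over `[N, 2N]` would give about `N ^ (1 - 2b)` on one side. On the other side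
it would give at most `‖g‖₁` times an oscillatory integral that van der Corput bounds by `C N ^ (1 -
a/2)`, uniformly in the frequency. This is impossible for `4b < a`, and `α + β < 1` leaves room for
such exponents inside the class. -/

open Set FourierTransform

/-! ### Plancherel's theorem for Fourier integrals. -/

/-- On `L¹ ∩ L²` the Fourier integral represents the `L²` Fourier transform. -/
theorem MeasureTheory.Lp.fourier_toLp_ae_eq {f : ℝ → ℂ} (h1 : Integrable f) (h2 : MemLp f 2) :
    (𝓕 (h2.toLp f) : Lp ℂ 2 (volume : Measure ℝ)) =ᵐ[volume] 𝓕 f := by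
  have hcont : Continuous (𝓕 f) :=
    VectorFourier.fourierIntegral_continuous Real.continuous_fourierChar
      (L := innerₗ ℝ) continuous_inner h1
  refine ae_eq_of_integral_contDiff_smul_eq
    ((Lp.memLp _).locallyIntegrable (by norm_num)) hcont.locallyIntegrable ?_
  intro g g_smooth g_cpt
  have hg₁ : HasCompactSupport (Complex.ofRealCLM ∘ g) := g_cpt.comp_left rfl
  have hg₂ : ContDiff ℝ (⊤ : ℕ∞) (Complex.ofRealCLM ∘ g) := by fun_prop
  set φ : SchwartzMap ℝ ℂ := hg₁.toSchwartzMap hg₂ with hφ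
  have hφg : ∀ x, φ x = (g x : ℂ) := fun x => by simp [hφ]
  -- As a tempered distribution the `L²` transform is defined by moving `𝓕` onto the test function;
  -- the multiplication formula for integrable functions moves it back onto `f`.
  have e1 := congrArg (fun T => T φ) (Lp.fourier_toTemperedDistribution_eq (h2.toLp f))
  simp only [TemperedDistribution.fourier_apply, Lp.toTemperedDistribution_apply] at e1
  calc ∫ x, g x • (𝓕 (h2.toLp f) : Lp ℂ 2 (volume : Measure ℝ)) x
      = ∫ x, φ x • (𝓕 (h2.toLp f) : Lp ℂ 2 (volume : Measure ℝ)) x := by simp [hφg]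
    _ = ∫ x, (𝓕 φ) x • (h2.toLp f) x := e1.symm
    _ = ∫ x, f x • (𝓕 φ) x := by
        apply integral_congr_ae
        filter_upwards [h2.coeFn_toLp] with x hx
        rw [hx, smul_eq_mul, smul_eq_mul, mul_comm]
    _ = ∫ x, f x • 𝓕 (φ : ℝ → ℂ) x := by rw [SchwartzMap.fourier_coe]
    _ = ∫ x, (𝓕 f x) • φ x := by
        have := VectorFourier.integral_fourierIntegral_smul_eq_flip (μ := volume) (ν := volume)
          (f := f) (g := (φ : ℝ → ℂ)) (e := Real.fourierChar) (L := innerₗ ℝ)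
          Real.continuous_fourierChar continuous_inner h1 φ.integrable
        rw [flip_innerₗ] at this
        exact this.symm
    _ = ∫ x, g x • 𝓕 f x := by
        simp [hφg, mul_comm]

theorem memLp_fourier_two {f : ℝ → ℂ} (h1 : Integrable f) (h2 : MemLp f 2) :
    MemLp (𝓕 f) 2 :=
  (memLp_congr_ae (Lp.fourier_toLp_ae_eq h1 h2)).1 (Lp.memLp _)

/-- Plancherel's identity for the Fourier integral. -/
theorem integral_norm_fourier_sq {f : ℝ → ℂ} (h1 : Integrable f) (h2 : MemLp f 2) :
    ∫ ξ, ‖𝓕 f ξ‖ ^ 2 = ∫ x, ‖f x‖ ^ 2 := by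
  have key : eLpNorm (𝓕 f) 2 volume = eLpNorm f 2 volume := by
    rw [← eLpNorm_congr_ae (Lp.fourier_toLp_ae_eq h1 h2), ← eLpNorm_congr_ae h2.coeFn_toLp]
    have := Lp.norm_fourier_eq (h2.toLp f)
    rw [Lp.norm_def, Lp.norm_def] at this
    exact (ENNReal.toReal_eq_toReal_iff' (Lp.memLp _).2.ne (Lp.memLp _).2.ne).1 this
  have e := memLp_fourier_two h1 h2
  rw [e.eLpNorm_eq_integral_rpow_norm (by norm_num) (by norm_num),
    h2.eLpNorm_eq_integral_rpow_norm (by norm_num) (by norm_num)] at key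
  have h0 := (ENNReal.ofReal_eq_ofReal_iff (by positivity) (by positivity)).1 key
  have h3 := (Real.rpow_left_inj (by positivity) (by positivity) (by norm_num)).1 h0
  simpa using h3


/-! ### Complex-valued absolutely continuous functions. -/

/-- Applied to real and imaginary parts, this carries the real-valued theory over to `ℂ`. -/
theorem AbsolutelyContinuousOnInterval.clm_comp {f : ℝ → ℂ} {a b : ℝ}
    (hf : AbsolutelyContinuousOnInterval f a b) (T : ℂ →L[ℝ] ℝ) :
    AbsolutelyContinuousOnInterval (fun x => T (f x)) a b := by
  unfold AbsolutelyContinuousOnInterval at hf ⊢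
  refine squeeze_zero (fun t => Finset.sum_nonneg fun i _ => dist_nonneg) (fun t => ?_)
    (by simpa using hf.const_mul ‖T‖)
  rw [Finset.mul_sum]
  exact Finset.sum_le_sum fun i _ => T.lipschitz.dist_le_mul _ _

theorem AbsolutelyContinuousOnInterval.ae_differentiableAt_complex {f : ℝ → ℂ} {a b : ℝ}
    (hf : AbsolutelyContinuousOnInterval f a b) :
    ∀ᵐ x : ℝ, x ∈ uIcc a b → DifferentiableAt ℝ f x := by
  filter_upwards [(hf.clm_comp Complex.reCLM).ae_differentiableAt,
    (hf.clm_comp Complex.imCLM).ae_differentiableAt] with x h1 h2 hx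
  have h1 := (Complex.ofRealCLM.differentiableAt (x := Complex.reCLM (f x))).comp x (h1 hx)
  have h2 := (Complex.ofRealCLM.differentiableAt (x := Complex.imCLM (f x))).comp x (h2 hx)
  refine (h1.add (h2.mul_const Complex.I)).congr_of_eventuallyEq (Eventually.of_forall fun y => ?_)
  simp [Complex.re_add_im]

theorem AbsolutelyContinuousOnInterval.integral_deriv_eq_sub_complex {f : ℝ → ℂ} {a b : ℝ}
    (hf : AbsolutelyContinuousOnInterval f a b) :
    IntervalIntegrable (deriv f) volume a b ∧ ∫ x in a..b, deriv f x = f b - f a := by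
  have hr := hf.clm_comp Complex.reCLM
  have hi := hf.clm_comp Complex.imCLM
  have hd : ∀ᵐ x : ℝ, x ∈ uIcc a b →
      ((deriv (fun x => Complex.reCLM (f x)) x : ℝ) : ℂ)
        + ((deriv (fun x => Complex.imCLM (f x)) x : ℝ) : ℂ) * Complex.I = deriv f x := by
    filter_upwards [hf.ae_differentiableAt_complex] with x hx hxm
    have h := (hx hxm).hasDerivAt
    have h1 := (Complex.reCLM.hasFDerivAt (x := f x)).comp_hasDerivAt x h
    have h2 := (Complex.imCLM.hasFDerivAt (x := f x)).comp_hasDerivAt x h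
    have e1 : deriv (fun x => Complex.reCLM (f x)) x = (deriv f x).re := h1.deriv
    have e2 : deriv (fun x => Complex.imCLM (f x)) x = (deriv f x).im := h2.deriv
    rw [e1, e2, Complex.re_add_im]
  have hd' : ∀ᵐ x : ℝ, x ∈ uIoc a b →
      ((deriv (fun x => Complex.reCLM (f x)) x : ℝ) : ℂ)
        + ((deriv (fun x => Complex.imCLM (f x)) x : ℝ) : ℂ) * Complex.I = deriv f x := by
    filter_upwards [hd] with x hx hm using hx (uIoc_subset_uIcc hm)
  have ir : IntervalIntegrable (fun x => ((deriv (fun x => Complex.reCLM (f x)) x : ℝ) : ℂ))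
      volume a b := ⟨hr.intervalIntegrable_deriv.1.ofReal, hr.intervalIntegrable_deriv.2.ofReal⟩
  have ii : IntervalIntegrable (fun x => ((deriv (fun x => Complex.imCLM (f x)) x : ℝ) : ℂ)
      * Complex.I) volume a b :=
    IntervalIntegrable.mul_const
      ⟨hi.intervalIntegrable_deriv.1.ofReal, hi.intervalIntegrable_deriv.2.ofReal⟩ _
  refine ⟨(ir.add ii).congr_ae ?_, ?_⟩
  · exact (ae_restrict_iff' measurableSet_uIoc).2 hd'
  · rw [← intervalIntegral.integral_congr_ae hd', intervalIntegral.integral_add ir ii,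
      intervalIntegral.integral_mul_const, intervalIntegral.integral_ofReal,
      intervalIntegral.integral_ofReal, hr.integral_deriv_eq_sub, hi.integral_deriv_eq_sub]
    apply Complex.ext <;> simp

/-- A bound for the derivative of an absolutely continuous function is a Lipschitz constant. -/
theorem AbsolutelyContinuousOnInterval.norm_sub_le_of_ae_norm_deriv_le {f : ℝ → ℂ} {a b D : ℝ}
    (hf : AbsolutelyContinuousOnInterval f a b) (hab : a ≤ b)
    (hD : ∀ᵐ x : ℝ, x ∈ Icc a b → ‖deriv f x‖ ≤ D) {x y : ℝ} (hx : x ∈ Icc a b)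
    (hy : y ∈ Icc a b) : ‖f x - f y‖ ≤ D * |x - y| := by
  have hs : uIcc y x ⊆ Icc a b := by
    rw [← uIcc_of_le hab] at hx hy ⊢; exact uIcc_subset_uIcc hy hx
  have := (hf.mono (c := y) (d := x) (by rwa [uIcc_of_le hab])).integral_deriv_eq_sub_complex.2
  rw [← this]
  refine intervalIntegral.norm_integral_le_of_norm_le_const_ae ?_
  filter_upwards [hD] with t ht hm using ht (hs (uIoc_subset_uIcc hm))

/-! ### The `A(ℝ)`-norm of a compactly supported Lipschitz function. -/

/-- Fourier inversion, rescaled from the kernel `e^{2πiξy}` to `e^{ixy}`; the factor `(2π)⁻¹` keeps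
the `L¹` norm unchanged. -/
theorem exists_integrable_rep_of_fourier {h : ℝ → ℂ} (hc : Continuous h) (hi : Integrable h)
    (hF : Integrable (𝓕 h)) :
    ∃ g : ℝ → ℂ, Integrable g ∧
      (∀ y : ℝ, h y = ∫ x : ℝ, g x * Complex.exp (Complex.I * ((x * y : ℝ) : ℂ))) ∧
      ∫ x, ‖g x‖ = ∫ ξ, ‖𝓕 h ξ‖ := by
  have hpi : (0 : ℝ) < 2 * Real.pi := by positivity
  refine ⟨fun x => ((2 * Real.pi : ℝ) : ℂ)⁻¹ * 𝓕 h (x / (2 * Real.pi)),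
    (hF.comp_div hpi.ne').const_mul _, fun y => ?_, ?_⟩
  · conv_lhs => rw [← hc.fourierInv_fourier_eq hi hF, Real.fourierInv_eq']
    have := Measure.integral_comp_div (fun ξ : ℝ => ((2 * Real.pi : ℝ) : ℂ)⁻¹ *
      (Complex.exp (((2 * Real.pi * inner ℝ ξ y : ℝ) : ℂ) * Complex.I) • 𝓕 h ξ)) (2 * Real.pi)
    rw [integral_const_mul _ (fun ξ : ℝ => Complex.exp (((2 * Real.pi * inner ℝ ξ y : ℝ) : ℂ) *
      Complex.I) • 𝓕 h ξ), abs_of_pos hpi, Complex.real_smul, mul_inv_cancel_left₀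
      (by exact_mod_cast hpi.ne')] at this
    rw [← this]
    refine integral_congr_ae (Eventually.of_forall fun x => ?_)
    have e : Complex.exp (((2 * Real.pi * inner ℝ (x / (2 * Real.pi)) y : ℝ) : ℂ) * Complex.I)
        = Complex.exp (Complex.I * ((x * y : ℝ) : ℂ)) := by
      rw [mul_comm Complex.I]
      congr 3
      simp only [RCLike.inner_apply, conj_trivial]
      field_simp
    simp only [e, smul_eq_mul]
    ring
  · have := Measure.integral_comp_div (fun ξ : ℝ => (2 * Real.pi)⁻¹ * ‖𝓕 h ξ‖) (2 * Real.pi)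
    rw [integral_const_mul _ (fun ξ : ℝ => ‖𝓕 h ξ‖), abs_of_pos hpi, smul_eq_mul,
      mul_inv_cancel_left₀ hpi.ne'] at this
    rw [← this]
    refine integral_congr_ae (Eventually.of_forall fun x => ?_)
    simp [abs_of_pos Real.pi_pos]

theorem memLp_indicator_Ioo {g : ℝ → ℂ} {a b C : ℝ} (p : ENNReal) (hm : Measurable g)
    (hC : ∀ x ∈ Ioo a b, ‖g x‖ ≤ C) : MemLp ((Ioo a b).indicator g) p := by
  rw [memLp_indicator_iff_restrict measurableSet_Ioo]
  exact MemLp.of_bound hm.aestronglyMeasurable C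
    ((ae_restrict_iff' measurableSet_Ioo).2 (Eventually.of_forall hC))

theorem integral_indicator_Ioo_sq_le {g : ℝ → ℂ} {a b C : ℝ} (hab : a ≤ b)
    (hC : ∀ x ∈ Ioo a b, ‖g x‖ ≤ C) :
    ∫ x, ‖(Ioo a b).indicator g x‖ ^ 2 ≤ (b - a) * C ^ 2 := by
  have e : ∀ x, ‖(Ioo a b).indicator g x‖ ^ 2 = (Ioo a b).indicator (fun x => ‖g x‖ ^ 2) x := by
    intro x
    by_cases hx : x ∈ Ioo a b <;> simp [hx]
  simp_rw [e]
  rw [integral_indicator measurableSet_Ioo]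
  have := norm_setIntegral_le_of_norm_le_const (μ := volume) (s := Ioo a b)
    (f := fun x => ‖g x‖ ^ 2) (C := C ^ 2) (by simp) (fun x hx => by
      rw [norm_pow, norm_norm]; exact pow_le_pow_left₀ (norm_nonneg _) (hC x hx) 2)
  rw [Real.volume_real_Ioo_of_le hab] at this
  linarith [le_trans (le_abs_self _) this]

theorem norm_deriv_le_of_mem_Ioo {h : ℝ → ℂ} {a b : ℝ} {D : NNReal}
    (hL : LipschitzOnWith D h (Icc a b)) {x : ℝ} (hx : x ∈ Ioo a b) : ‖deriv h x‖ ≤ D :=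
  norm_deriv_le_of_lipschitzOn (Icc_mem_nhds hx.1 hx.2) hL

/-- The Fourier transform turns the derivative of a compactly supported Lipschitz function into
multiplication. -/
theorem fourier_indicator_deriv {h : ℝ → ℂ} {a b : ℝ} {D : NNReal} (hab : a ≤ b)
    (hL : LipschitzOnWith D h (Icc a b)) (ha : h a = 0) (hb : h b = 0)
    (hout : ∀ x ∉ Ioo a b, h x = 0) (ξ : ℝ) :
    𝓕 ((Ioo a b).indicator (deriv h)) ξ = (2 * Real.pi * ξ : ℂ) * Complex.I * 𝓕 h ξ := by
  set c : ℂ := -(2 * Real.pi * ξ : ℂ) * Complex.I with hc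
  have hexp : ∀ x : ℝ, HasDerivAt (fun x : ℝ => Complex.exp (c * x)) (Complex.exp (c * x) * c) x :=
    fun x => by
      simpa using ((Complex.ofRealCLM.hasDerivAt (x := x)).const_mul c).cexp
  have hE : AbsolutelyContinuousOnInterval (fun x : ℝ => Complex.exp (c * x)) a b := by
    refine ContDiffOn.absolutelyContinuousOnInterval (ContDiff.contDiffOn ?_)
    exact ((contDiff_const.mul Complex.ofRealCLM.contDiff).cexp)
  have hA : AbsolutelyContinuousOnInterval h a b :=
    LipschitzOnWith.absolutelyContinuousOnInterval (K := D) (by rwa [uIcc_of_le hab])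
  have hprod := (hE.fun_smul hA).integral_deriv_eq_sub_complex
  have hcE : Continuous (fun x : ℝ => Complex.exp (c * x)) := by fun_prop
  have i1 : IntervalIntegrable (fun x : ℝ => Complex.exp (c * x) * deriv h x) volume a b :=
    hA.integral_deriv_eq_sub_complex.1.continuousOn_mul hcE.continuousOn
  have i2 : IntervalIntegrable (fun x : ℝ => Complex.exp (c * x) * h x) volume a b :=
    (hcE.continuousOn.mul hA.continuousOn).intervalIntegrable
  have hd : ∀ᵐ x : ℝ, x ∈ uIoc a b → deriv (fun x : ℝ => Complex.exp (c * x) • h x) x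
      = Complex.exp (c * x) * deriv h x + c * (Complex.exp (c * x) * h x) := by
    filter_upwards [hA.ae_differentiableAt_complex] with x hx hm
    have := (hexp x).mul (hx (uIoc_subset_uIcc hm)).hasDerivAt
    have e := this.deriv
    simp only [smul_eq_mul]
    refine Eq.trans ?_ (e.trans ?_)
    · rfl
    · ring
  -- Integration by parts: the integral of the derivative of `e^{cx} h x` is a boundary term, which
  -- vanishes.
  have hz := hprod.2
  rw [intervalIntegral.integral_congr_ae hd, intervalIntegral.integral_add i1 (i2.const_mul c),
    intervalIntegral.integral_const_mul, ha, hb, smul_zero, smul_zero, sub_zero] at hz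
  have key : ∀ u : ℝ → ℂ, 𝓕 ((Ioo a b).indicator u) ξ
      = ∫ x in a..b, Complex.exp (c * x) * u x := by
    intro u
    rw [Real.fourier_eq', intervalIntegral.integral_of_le hab, integral_Ioc_eq_integral_Ioo,
      ← integral_indicator measurableSet_Ioo]
    refine integral_congr_ae (Eventually.of_forall fun x => ?_)
    by_cases hx : x ∈ Ioo a b
    · simp only [hx, indicator_of_mem, smul_eq_mul, hc]
      congr 2
      simp only [RCLike.inner_apply, conj_trivial]
      push_cast
      ring
    · simp [hx]
  have hh : (Ioo a b).indicator h = h := by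
    ext x
    by_cases hx : x ∈ Ioo a b
    · simp [hx]
    · simp [hx, hout x hx]
  have kh := key h
  rw [hh] at kh
  rw [key, kh]
  rw [eq_neg_of_add_eq_zero_left hz, hc]
  ring

/-- A Lipschitz function supported in an interval is the Fourier integral of an integrable
function whose norm is controlled by the geometric mean of its size and its slope. -/
theorem exists_rep_of_lipschitz {h : ℝ → ℂ} {a b S : ℝ} {D : NNReal} (hab : a < b)
    (hL : LipschitzOnWith D h (Icc a b)) (hS0 : 0 < S) (hD0 : 0 < D)
    (hS : ∀ x ∈ Icc a b, ‖h x‖ ≤ S) (hout : ∀ x ∉ Ioo a b, h x = 0) :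
    ∃ g : ℝ → ℂ, Integrable g ∧
      (∀ y : ℝ, h y = ∫ x : ℝ, g x * Complex.exp (Complex.I * ((x * y : ℝ) : ℂ))) ∧
      ∫ x, ‖g x‖ ≤ 3 * √((b - a) * S * D) := by
  have ha : h a = 0 := hout a (by simp)
  have hb : h b = 0 := hout b (by simp)
  have hh : (Ioo a b).indicator h = h := by
    ext x
    by_cases hx : x ∈ Ioo a b
    · simp [hx]
    · simp [hx, hout x hx]
  have hcont : Continuous h := by
    have h1 : ContinuousOn h (Icc a b) := hL.continuousOn
    -- As `h` vanishes at the endpoints and beyond them, it is unchanged by first projecting onto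
    -- `[a, b]`.
    have e : h = fun x => h (max a (min b x)) := by
      ext x
      rcases lt_trichotomy x a with hx | hx | hx
      · rw [min_eq_right (by linarith), max_eq_left hx.le, ha, hout x (by simp [hx.le])]
      · rw [hx, min_eq_right hab.le, max_eq_left le_rfl]
      · rcases le_total x b with hxb | hxb
        · rw [min_eq_right hxb, max_eq_right hx.le]
        · rw [min_eq_left hxb, max_eq_right hab.le, hb, hout x (by simp [hxb])]
    rw [e]
    exact h1.comp_continuous (by fun_prop) fun x =>
      ⟨le_max_left _ _, max_le hab.le (min_le_left _ _)⟩
  have hSo : ∀ x ∈ Ioo a b, ‖h x‖ ≤ S := fun x hx => hS x (Ioo_subset_Icc_self hx)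
  have hDo : ∀ x ∈ Ioo a b, ‖deriv h x‖ ≤ D := fun x hx => norm_deriv_le_of_mem_Ioo hL hx
  have m1 : Integrable h := memLp_one_iff_integrable.1
    (hh ▸ memLp_indicator_Ioo 1 hcont.measurable hSo)
  have m2 : MemLp h 2 := hh ▸ memLp_indicator_Ioo 2 hcont.measurable hSo
  have d1 : Integrable ((Ioo a b).indicator (deriv h)) := memLp_one_iff_integrable.1
    (memLp_indicator_Ioo 1 (measurable_deriv h) hDo)
  have d2 : MemLp ((Ioo a b).indicator (deriv h)) 2 :=
    memLp_indicator_Ioo 2 (measurable_deriv h) hDo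
  have b1 : ∫ ξ, ‖𝓕 h ξ‖ ^ 2 ≤ (b - a) * S ^ 2 := by
    rw [integral_norm_fourier_sq m1 m2, ← hh]
    exact integral_indicator_Ioo_sq_le hab.le hSo
  have b2 : ∫ ξ, ‖𝓕 ((Ioo a b).indicator (deriv h)) ξ‖ ^ 2 ≤ (b - a) * (D : ℝ) ^ 2 := by
    rw [integral_norm_fourier_sq d1 d2]
    exact integral_indicator_Ioo_sq_le hab.le hDo
  have e2 : ∀ ξ, ‖𝓕 ((Ioo a b).indicator (deriv h)) ξ‖ ^ 2
      = (2 * Real.pi * ξ) ^ 2 * ‖𝓕 h ξ‖ ^ 2 := by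
    intro ξ
    rw [fourier_indicator_deriv hab.le hL ha hb hout, norm_mul, norm_mul, Complex.norm_I, mul_one,
      mul_pow]
    congr 1
    rw [← Complex.ofReal_ofNat, ← Complex.ofReal_mul, ← Complex.ofReal_mul, Complex.norm_real,
      Real.norm_eq_abs, sq_abs]
  have i1 : Integrable fun ξ => ‖𝓕 h ξ‖ ^ 2 :=
    (memLp_fourier_two m1 m2).integrable_norm_pow (by norm_num)
  have i2 : Integrable fun ξ => ‖𝓕 ((Ioo a b).indicator (deriv h)) ξ‖ ^ 2 :=
    (memLp_fourier_two d1 d2).integrable_norm_pow (by norm_num)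
  have hD : (0 : ℝ) < D := hD0
  have hba : 0 < b - a := sub_pos.2 hab
  -- At the length scale `l = S / D` the `L²` bounds for `h` and `l h'` coincide. The weighted AM–GM
  -- bound `B` replaces Cauchy–Schwarz, and this `ε` makes both of its terms multiples of `√((b - a)
  -- S D)`.
  set ε : ℝ := √(D / ((b - a) * S ^ 3)) with hε
  have hε0 : 0 < ε := Real.sqrt_pos.2 (by positivity)
  set l : ℝ := S / D with hl
  have hl0 : 0 < l := by positivity
  have i3 : Integrable fun ξ : ℝ => (1 + (l * ξ) ^ 2)⁻¹ :=
    integrable_inv_one_add_sq.comp_mul_left' hl0.ne'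
  set B : ℝ → ℝ := fun ξ => ε / 2 * (‖𝓕 h ξ‖ ^ 2
      + l ^ 2 * ‖𝓕 ((Ioo a b).indicator (deriv h)) ξ‖ ^ 2) + (2 * ε)⁻¹ * (1 + (l * ξ) ^ 2)⁻¹ with hB
  have i12 : Integrable fun ξ => ‖𝓕 h ξ‖ ^ 2
      + l ^ 2 * ‖𝓕 ((Ioo a b).indicator (deriv h)) ξ‖ ^ 2 := i1.add (i2.const_mul _)
  have iB : Integrable B := (i12.const_mul _).add (i3.const_mul _)
  have hle : ∀ ξ, ‖𝓕 h ξ‖ ≤ B ξ := by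
    intro ξ
    have hpi : (1 : ℝ) ≤ (2 * Real.pi) ^ 2 := by nlinarith [Real.pi_gt_three]
    have q : 0 < 1 + (l * ξ) ^ 2 := by positivity
    set F := ‖𝓕 h ξ‖ with hF
    have s1 : ε / 2 * (F ^ 2 * (1 + (l * ξ) ^ 2)) + (2 * ε)⁻¹ * (1 + (l * ξ) ^ 2)⁻¹ ≤ B ξ := by
      simp only [hB, e2]
      have : F ^ 2 * (1 + (l * ξ) ^ 2) ≤ F ^ 2 + l ^ 2 * ((2 * Real.pi * ξ) ^ 2 * F ^ 2) := by
        have h0 : 0 ≤ (l * ξ * F) ^ 2 := sq_nonneg _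
        nlinarith
      gcongr
    refine le_trans ?_ s1
    have s2 : 0 ≤ (ε * (1 + (l * ξ) ^ 2) * F - 1) ^ 2 / (2 * ε * (1 + (l * ξ) ^ 2)) := by
      positivity
    have s3 : ε / 2 * (F ^ 2 * (1 + (l * ξ) ^ 2)) + (2 * ε)⁻¹ * (1 + (l * ξ) ^ 2)⁻¹ - F
        = (ε * (1 + (l * ξ) ^ 2) * F - 1) ^ 2 / (2 * ε * (1 + (l * ξ) ^ 2)) := by
      field_simp
      ring
    linarith
  have hFc : Continuous (𝓕 h) :=
    VectorFourier.fourierIntegral_continuous Real.continuous_fourierChar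
      (L := innerₗ ℝ) continuous_inner m1
  have iF : Integrable (𝓕 h) := iB.mono' hFc.aestronglyMeasurable (Eventually.of_forall hle)
  obtain ⟨g, hg, hrep, hn⟩ := exists_integrable_rep_of_fourier hcont m1 iF
  refine ⟨g, hg, hrep, ?_⟩
  rw [hn]
  refine (integral_mono iF.norm iB hle).trans ?_
  have hint : ∫ ξ, B ξ = ε / 2 * ((∫ ξ, ‖𝓕 h ξ‖ ^ 2)
      + l ^ 2 * ∫ ξ, ‖𝓕 ((Ioo a b).indicator (deriv h)) ξ‖ ^ 2) + (2 * ε)⁻¹ * (l⁻¹ * Real.pi) := by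
    simp only [hB]
    rw [integral_add (i12.const_mul _) (i3.const_mul _), integral_const_mul,
      integral_const_mul, integral_add i1 (i2.const_mul _), integral_const_mul,
      Measure.integral_comp_mul_left (fun x => (1 + x ^ 2)⁻¹) l, integral_univ_inv_one_add_sq,
      abs_of_pos (inv_pos.2 hl0), smul_eq_mul]
  rw [hint]
  set T := √((b - a) * S * D) with hT
  have hT0 : 0 < T := Real.sqrt_pos.2 (by positivity)
  have hT2 : T ^ 2 = (b - a) * S * D := Real.sq_sqrt (by positivity)
  have hεT : ε * ((b - a) * S ^ 2) = T := by
    have h2 : (ε * ((b - a) * S ^ 2)) ^ 2 = T ^ 2 := by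
      rw [hT2, mul_pow, hε, Real.sq_sqrt (by positivity)]
      field_simp
    exact (pow_left_inj₀ (by positivity) hT0.le two_ne_zero).1 h2
  have hεT' : ε⁻¹ * l⁻¹ = T := by
    have : ε = T / ((b - a) * S ^ 2) := by rw [← hεT]; field_simp
    rw [this, hl, inv_div, inv_div]
    field_simp
    rw [hT2]
  calc _ ≤ ε / 2 * ((b - a) * S ^ 2 + l ^ 2 * ((b - a) * (D : ℝ) ^ 2))
        + (2 * ε)⁻¹ * (l⁻¹ * Real.pi) := by gcongr
    _ = ε * ((b - a) * S ^ 2) + (ε⁻¹ * l⁻¹) * (Real.pi / 2) := by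
        rw [hl, mul_inv]; field_simp; ring
    _ = T * (1 + Real.pi / 2) := by rw [hεT, hεT']; ring
    _ ≤ 3 * T := by nlinarith [Real.pi_lt_four]

/-! ### Stability of `A(ℝ)` under sums, scalars and reflection. -/

theorem integrable_tsum_of_summable_integral_norm {ι : Type*} [Countable ι] {g : ι → ℝ → ℂ}
    (hg : ∀ i, Integrable (g i)) (hs : Summable fun i => ∫ x, ‖g i x‖) :
    Integrable fun x => ∑' i, g i x := by
  have hm : AEStronglyMeasurable (fun x => ∑' i, g i x) volume := by
    choose g' hg' hgg using fun i => (hg i).1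
    refine AEStronglyMeasurable.congr (f := fun x => ∑' i, g' i x) ?_ ?_
    · exact (StronglyMeasurable.tsum hg').aestronglyMeasurable
    · filter_upwards [ae_all_iff.2 hgg] with x hx
      exact tsum_congr fun i => (hx i).symm
  refine ⟨hm, ?_⟩
  have e : ∀ i, ∫⁻ x, ‖g i x‖ₑ = ENNReal.ofReal (∫ x, ‖g i x‖) := fun i => by
    rw [ofReal_integral_norm_eq_lintegral_enorm (hg i)]
  calc ∫⁻ x, ‖∑' i, g i x‖ₑ ≤ ∫⁻ x, ∑' i, ‖g i x‖ₑ :=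
        lintegral_mono fun x => enorm_tsum_le_tsum_enorm
    _ = ∑' i, ENNReal.ofReal (∫ x, ‖g i x‖) := by
        rw [lintegral_tsum fun i => (hg i).1.enorm]
        simp_rw [e]
    _ < ⊤ := lt_top_iff_ne_top.2 hs.tsum_ofReal_ne_top

theorem norm_mul_exp_I_mul (z : ℂ) (r : ℝ) : ‖z * Complex.exp (Complex.I * (r : ℂ))‖ = ‖z‖ := by
  rw [norm_mul, mul_comm Complex.I, Complex.norm_exp_ofReal_mul_I, mul_one]

theorem MeasureTheory.Integrable.mul_exp_I_mul {g : ℝ → ℂ} (hg : Integrable g) (y : ℝ) :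
    Integrable fun x : ℝ => g x * Complex.exp (Complex.I * ((x * y : ℝ) : ℂ)) := by
  refine hg.norm.mono' (hg.1.mul (by fun_prop)) (Eventually.of_forall fun x => ?_)
  rw [norm_mul_exp_I_mul]

/-- Completeness of `L¹`: the representing functions sum to an integrable one, and the series may be
integrated term by term. Pointwise convergence to `f` is therefore enough. -/
theorem MemFourierA.of_hasSum {ι : Type*} [Countable ι] {f : ℝ → ℂ} {h : ι → ℝ → ℂ} {c : ι → ℝ}
    (hrep : ∀ i, ∃ g : ℝ → ℂ, Integrable g ∧
      (∀ y : ℝ, h i y = ∫ x : ℝ, g x * Complex.exp (Complex.I * ((x * y : ℝ) : ℂ))) ∧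
      ∫ x, ‖g x‖ ≤ c i) (hc : Summable c) (hf : ∀ y, HasSum (fun i => h i y) (f y)) :
    MemFourierA f := by
  choose g hg hgr hgn using hrep
  have hs : Summable fun i => ∫ x, ‖g i x‖ :=
    hc.of_nonneg_of_le (fun i => integral_nonneg fun x => norm_nonneg _) hgn
  refine ⟨fun x => ∑' i, g i x, integrable_tsum_of_summable_integral_norm hg hs, fun y => ?_⟩
  have := hasSum_integral_of_summable_integral_norm
    (F := fun i (x : ℝ) => g i x * Complex.exp (Complex.I * ((x * y : ℝ) : ℂ)))
    (fun i => (hg i).mul_exp_I_mul y) (by simpa only [norm_mul_exp_I_mul] using hs)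
  simp only [tsum_mul_right] at this
  refine HasSum.unique ?_ this
  simpa only [← hgr] using hf y

theorem MemFourierA.add {f₁ f₂ : ℝ → ℂ} (h₁ : MemFourierA f₁) (h₂ : MemFourierA f₂) :
    MemFourierA fun y => f₁ y + f₂ y := by
  obtain ⟨g₁, i₁, e₁⟩ := h₁
  obtain ⟨g₂, i₂, e₂⟩ := h₂
  refine ⟨fun x => g₁ x + g₂ x, i₁.add i₂, fun y => ?_⟩
  simp only [add_mul]
  rw [integral_add (i₁.mul_exp_I_mul y) (i₂.mul_exp_I_mul y), e₁, e₂]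

theorem MemFourierA.const_mul {f : ℝ → ℂ} (h : MemFourierA f) (c : ℂ) :
    MemFourierA fun y => c * f y := by
  obtain ⟨g, i, e⟩ := h
  refine ⟨fun x => c * g x, i.const_mul c, fun y => ?_⟩
  simp only [mul_assoc]
  rw [integral_const_mul, e]

theorem MemFourierA.comp_neg {f : ℝ → ℂ} (h : MemFourierA f) : MemFourierA fun y => f (-y) := by
  obtain ⟨g, i, e⟩ := h
  refine ⟨fun x => g (-x), i.comp_neg, fun y => ?_⟩
  change f (-y) = _
  rw [e, ← integral_neg_eq_self]
  simp

/-! ### Dyadic partition of unity and the summability criterion. -/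

/-- The function that is affine on `[1/2, 1]` and `[1, 2]`, equals `1` at `1`, and vanishes outside
`[1/2, 2]`. -/
def dyadicTent (s : ℝ) : ℝ := max 0 (min (2 * s - 1) (2 - s))

theorem dyadicTent_nonneg (s : ℝ) : 0 ≤ dyadicTent s := le_max_left _ _

theorem dyadicTent_le_one (s : ℝ) : dyadicTent s ≤ 1 := by
  unfold dyadicTent
  refine max_le zero_le_one ?_
  rcases le_total s 1 with h | h
  · exact (min_le_left _ _).trans (by linarith)
  · exact (min_le_right _ _).trans (by linarith)

theorem dyadicTent_eq_zero_of_le {s : ℝ} (h : s ≤ 1 / 2) : dyadicTent s = 0 :=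
  max_eq_left ((min_le_left _ _).trans (by linarith))

theorem dyadicTent_eq_zero_of_ge {s : ℝ} (h : 2 ≤ s) : dyadicTent s = 0 :=
  max_eq_left ((min_le_right _ _).trans (by linarith))

theorem abs_dyadicTent_sub_le (s t : ℝ) : |dyadicTent s - dyadicTent t| ≤ 2 * |s - t| := by
  unfold dyadicTent
  refine (abs_max_sub_max_le_max _ _ _ _).trans ?_
  rw [sub_self, abs_zero]
  refine max_le (by positivity) ((abs_min_sub_min_le_max _ _ _ _).trans (max_le ?_ ?_))
  · rw [show 2 * s - 1 - (2 * t - 1) = 2 * (s - t) by ring, abs_mul, abs_two]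
  · rw [show 2 - s - (2 - t) = -(s - t) by ring, abs_neg]
    linarith [abs_nonneg (s - t)]

/-- For `2 ^ n ≤ t < 2 ^ (n + 1)` and `u = t / 2 ^ n`, only `k = n` and `k = n + 1` contribute, with
values `2 - u` and `u - 1`. -/
theorem hasSum_dyadicTent {t : ℝ} (ht : 0 < t) :
    HasSum (fun k : ℤ => dyadicTent (t / 2 ^ k)) 1 := by
  obtain ⟨n, hn1, hn2⟩ := exists_mem_Ico_zpow ht one_lt_two
  have hp : (0 : ℝ) < 2 ^ n := by positivity
  rw [zpow_add_one₀ two_ne_zero] at hn2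
  have hu1 : 1 ≤ t / 2 ^ n := (one_le_div hp).2 hn1
  have hu2 : t / 2 ^ n < 2 := (div_lt_iff₀ hp).2 (by linarith)
  have hsum : ∑ k ∈ ({n, n + 1} : Finset ℤ), dyadicTent (t / 2 ^ k) = 1 := by
    rw [Finset.sum_pair (by omega)]
    have e : t / 2 ^ (n + 1) = t / 2 ^ n / 2 := by rw [zpow_add_one₀ two_ne_zero]; field_simp
    rw [e]
    unfold dyadicTent
    rw [min_eq_right (by linarith), min_eq_left (by linarith), max_eq_right (by linarith),
      max_eq_right (by linarith)]
    ring
  rw [← hsum]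
  refine hasSum_sum_of_ne_finset_zero fun k hk => ?_
  simp only [Finset.mem_insert, Finset.mem_singleton, not_or] at hk
  have hpk : (0 : ℝ) < 2 ^ k := by positivity
  rcases lt_or_ge k n with h | h
  · refine dyadicTent_eq_zero_of_ge ((le_div_iff₀ hpk).2 ?_)
    have : (2 : ℝ) ^ (k + 1) ≤ 2 ^ n := zpow_le_zpow_right₀ one_le_two (by omega)
    rw [zpow_add_one₀ two_ne_zero] at this
    linarith
  · refine dyadicTent_eq_zero_of_le ((div_le_iff₀ hpk).2 ?_)
    have : (2 : ℝ) ^ (n + 1 + 1) ≤ 2 ^ k := zpow_le_zpow_right₀ one_le_two (by omega)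
    rw [zpow_add_one₀ two_ne_zero, zpow_add_one₀ two_ne_zero] at this
    linarith

/-- A function on the half-line belongs to `A(ℝ)` if its sizes `S k` and its scaled slopes `E k` on
the dyadic intervals are such that `∑ √(S k * E k) < ∞`. -/
theorem MemFourierA.of_dyadic {p : ℝ → ℂ} (hp0 : ∀ t ≤ 0, p t = 0) {S E : ℤ → ℝ}
    (hS0 : ∀ k, 0 < S k) (hSE : ∀ k, S k ≤ E k) (hsum : Summable fun k => √(S k * E k))
    (hS : ∀ k : ℤ, ∀ t ∈ Icc ((2 : ℝ) ^ (k - 1)) (2 ^ (k + 1)), ‖p t‖ ≤ S k)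
    (hE : ∀ k : ℤ, ∀ t ∈ Icc ((2 : ℝ) ^ (k - 1)) (2 ^ (k + 1)),
      ∀ s ∈ Icc ((2 : ℝ) ^ (k - 1)) (2 ^ (k + 1)), ‖p t - p s‖ ≤ E k / 2 ^ k * |t - s|) :
    MemFourierA p := by
  have hE0 : ∀ k, 0 < E k := fun k => (hS0 k).trans_le (hSE k)
  refine MemFourierA.of_hasSum (h := fun (k : ℤ) t => p t * (dyadicTent (t / 2 ^ k) : ℂ))
    (c := fun k => 9 * √(S k * E k)) (fun k => ?_) (hsum.mul_left 9) (fun t => ?_)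
  · have hk : (0 : ℝ) < 2 ^ k := by positivity
    have e1 : (2 : ℝ) ^ (k - 1) = 2 ^ k / 2 := zpow_sub_one₀ two_ne_zero k
    have e2 : (2 : ℝ) ^ (k + 1) = 2 ^ k * 2 := zpow_add_one₀ two_ne_zero k
    have hS := hS k
    have hE := hE k
    rw [e1, e2] at hS hE
    -- Product rule: `p` contributes slope `E k / 2 ^ k`, the tent `2 * S k / 2 ^ k`, and `S k ≤ E
    -- k` merges the two.
    have hD : 0 < 3 * E k / 2 ^ k := by have := hE0 k; positivity
    have hnt : ∀ s, ‖(dyadicTent s : ℂ)‖ = dyadicTent s := fun s => by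
      rw [Complex.norm_real, Real.norm_of_nonneg (dyadicTent_nonneg s)]
    obtain ⟨g, hg, hgr, hgn⟩ := exists_rep_of_lipschitz
      (h := fun t => p t * (dyadicTent (t / 2 ^ k) : ℂ)) (a := 2 ^ k / 2) (b := 2 ^ k * 2)
      (S := S k) (D := ⟨3 * E k / 2 ^ k, hD.le⟩) (by linarith)
      (LipschitzOnWith.of_dist_le_mul fun t ht s hs => by
        rw [dist_eq_norm, Real.dist_eq]
        have h1 : p t * (dyadicTent (t / 2 ^ k) : ℂ) - p s * (dyadicTent (s / 2 ^ k) : ℂ)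
            = (p t - p s) * (dyadicTent (t / 2 ^ k) : ℂ)
              + p s * ((dyadicTent (t / 2 ^ k) - dyadicTent (s / 2 ^ k) : ℝ) : ℂ) := by
          push_cast; ring
        rw [h1]
        refine (norm_add_le _ _).trans ?_
        rw [norm_mul, norm_mul, hnt, Complex.norm_real, Real.norm_eq_abs]
        have h2 := abs_dyadicTent_sub_le (t / 2 ^ k) (s / 2 ^ k)
        rw [← sub_div, abs_div, abs_of_pos hk] at h2
        calc _ ≤ E k / 2 ^ k * |t - s| * 1 + E k * (2 * (|t - s| / 2 ^ k)) := by
              have := hE t ht s hs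
              have h3 := dyadicTent_le_one (t / 2 ^ k)
              have h4 := dyadicTent_nonneg (t / 2 ^ k)
              have h5 := (hS s hs).trans (hSE k)
              have h6 := hE0 k
              gcongr
          _ = 3 * E k / 2 ^ k * |t - s| := by field_simp; ring)
      (hS0 k) hD
      (fun t ht => by
        rw [norm_mul, hnt]
        calc _ ≤ S k * 1 := by
              have := hS t ht
              have h3 := dyadicTent_le_one (t / 2 ^ k)
              have h4 := dyadicTent_nonneg (t / 2 ^ k)
              gcongr
              exact (hS0 k).le
          _ = S k := mul_one _)
      (fun t ht => by
        have : dyadicTent (t / 2 ^ k) = 0 := by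
          rcases le_or_gt t (2 ^ k / 2) with h | h
          · exact dyadicTent_eq_zero_of_le ((div_le_iff₀ hk).2 (by linarith))
          · refine dyadicTent_eq_zero_of_ge ((le_div_iff₀ hk).2 ?_)
            by_contra h'
            exact ht ⟨h, by linarith⟩
        simp [this])
    refine ⟨g, hg, hgr, hgn.trans ?_⟩
    -- The support has length `3/2 * 2 ^ k`, so the quantity under the root is `9/2 * (S k * E k)`,
    -- here rounded up to `9 * (S k * E k)`.
    have h9 : (9 : ℝ) * √(S k * E k) = 3 * √(9 * (S k * E k)) := by
      rw [Real.sqrt_mul (by norm_num : (0 : ℝ) ≤ 9), show √(9 : ℝ) = 3 by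
        rw [show (9 : ℝ) = 3 ^ 2 by norm_num, Real.sqrt_sq (by norm_num)]]
      ring
    rw [h9]
    refine mul_le_mul_of_nonneg_left (Real.sqrt_le_sqrt ?_) (by norm_num)
    have hSk := hS0 k
    have hEk := hE0 k
    have : (2 ^ k * 2 - 2 ^ k / 2) * S k * (3 * E k / 2 ^ k) = 9 / 2 * (S k * E k) := by
      field_simp; ring
    change (2 ^ k * 2 - 2 ^ k / 2) * S k * (3 * E k / 2 ^ k) ≤ _
    rw [this]
    have : 0 < S k * E k := by positivity
    linarith
  · rcases le_or_gt t 0 with h | h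
    · simp [hp0 t h, hasSum_zero]
    · have := (Complex.hasSum_ofReal.2 (hasSum_dyadicTent h)).mul_left (p t)
      simpa using this

/-! ### The integral condition near the origin. -/

theorem derivMajorant_anti (f : ℝ → ℂ) {R R' t t' : ℝ} (ht : t ≤ t') (hR : R' ≤ R) :
    derivMajorant f R' t' ≤ derivMajorant f R t :=
  essSup_mono_measure (Measure.absolutelyContinuous_of_le (Measure.restrict_mono_set volume
    fun s (hs : t' ≤ |s| ∧ |s| ≤ R') => ⟨ht.trans hs.1, hs.2.trans hR⟩))

theorem ae_enorm_deriv_le_derivMajorant (f : ℝ → ℂ) (R t : ℝ) :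
    ∀ᵐ s : ℝ, t ≤ |s| ∧ |s| ≤ R → ‖deriv f s‖ₑ ≤ derivMajorant f R t := by
  have hm : MeasurableSet {s : ℝ | t ≤ |s| ∧ |s| ≤ R} :=
    (measurableSet_le measurable_const measurable_norm).inter
      (measurableSet_le measurable_norm measurable_const)
  exact (ae_restrict_iff' hm).1 (ENNReal.ae_le_essSup _)

theorem measurable_derivMajorant (f : ℝ → ℂ) (R : ℝ) : Measurable (derivMajorant f R) :=
  Antitone.measurable fun _ _ h => derivMajorant_anti f h le_rfl

theorem log_two_mul_lintegral_derivMajorant_le (f : ℝ → ℂ) (R : ℝ) :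
    ENNReal.ofReal (Real.log 2) * ∫⁻ s in Ioc (0 : ℝ) 1, derivMajorant f R s ≤ A1 f R := by
  rw [← lintegral_const_mul _ (measurable_derivMajorant f R), A1]
  refine setLIntegral_mono' measurableSet_Ioc fun s hs => ?_
  rw [mul_comm]
  gcongr
  rw [le_div_iff₀ hs.1]
  linarith [hs.2]

theorem lintegral_derivMajorant_lt_top {f : ℝ → ℂ} {R : ℝ} (h : A1 f R < ⊤) :
    ∫⁻ s in Ioc (0 : ℝ) 1, derivMajorant f R s < ⊤ := by
  have h1 := (log_two_mul_lintegral_derivMajorant_le f R).trans_lt h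
  rw [lt_top_iff_ne_top] at h1 ⊢
  intro h2
  rw [h2, ENNReal.mul_top (by simpa using Real.log_pos one_lt_two)] at h1
  exact h1 rfl

theorem ofReal_sub_mul_derivMajorant_le (f : ℝ → ℂ) (R : ℝ) (u v : ℝ) :
    derivMajorant f R v * ENNReal.ofReal (v - u) ≤ ∫⁻ s in Ioc u v, derivMajorant f R s := by
  rw [← Real.volume_Ioc, ← setLIntegral_const]
  exact setLIntegral_mono' measurableSet_Ioc fun s hs => derivMajorant_anti f hs.2 le_rfl

/-- A nonincreasing function with finite integral over `(0, 1]` is finite at every positive point.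
-/
theorem derivMajorant_lt_top {f : ℝ → ℂ} {R t : ℝ} (h : A1 f R < ⊤) (ht : 0 < t) :
    derivMajorant f R t < ⊤ := by
  refine (derivMajorant_anti f (min_le_left t 1) le_rfl).trans_lt ?_
  have ht' : 0 < min t 1 := lt_min ht one_pos
  have h1 := ((ofReal_sub_mul_derivMajorant_le f R 0 (min t 1)).trans
    (lintegral_mono_set (Ioc_subset_Ioc_right (min_le_right t 1)))).trans_lt
      (lintegral_derivMajorant_lt_top h)
  rw [lt_top_iff_ne_top] at h1 ⊢
  intro h2
  rw [h2, ENNReal.top_mul (by simpa using ht)] at h1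
  exact h1 rfl

/-- The series counts the `n` with `s ≤ 2⁻ⁿ`, that is `n ≤ log₂ (1 / s)`; including `n = 0` there
are at most `log₂ (2 / s)` of them. This is the source of the weight `ln (2 / t)`. -/
theorem log_two_mul_tsum_indicator_le {s : ℝ} (hs : 0 < s) (hs1 : s ≤ 1) :
    ENNReal.ofReal (Real.log 2) * ∑' n : ℕ, (Ioc (0 : ℝ) ((1 / 2) ^ n)).indicator (fun _ => 1) s
      ≤ ENNReal.ofReal (Real.log (2 / s)) := by
  have hl := Real.log_pos one_lt_two
  set N := ⌊Real.log (1 / s) / Real.log 2⌋₊ with hN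
  have hlog : 0 ≤ Real.log (1 / s) := Real.log_nonneg ((one_le_div hs).2 hs1)
  have h0 : ∀ n ∉ Finset.range (N + 1),
      (Ioc (0 : ℝ) ((1 / 2) ^ n)).indicator (fun _ => (1 : ENNReal)) s = 0 := by
    intro n hn
    refine indicator_of_notMem (fun hmem => hn ?_) _
    rw [Finset.mem_range, Nat.lt_succ_iff, hN]
    refine Nat.le_floor ((le_div_iff₀ hl).2 ?_)
    rw [← Real.log_pow]
    refine Real.log_le_log (by positivity) ?_
    have := hmem.2
    rw [one_div_pow] at this
    rwa [le_div_iff₀ hs, mul_comm, ← le_div_iff₀ (by positivity)]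
  rw [tsum_eq_sum h0]
  have h1 : ∑ n ∈ Finset.range (N + 1),
      (Ioc (0 : ℝ) ((1 / 2) ^ n)).indicator (fun _ => (1 : ENNReal)) s ≤ (N + 1 : ℕ) := by
    refine (Finset.sum_le_card_nsmul _ _ 1 fun n _ => ?_).trans (by simp)
    exact indicator_le_self' (fun _ _ => zero_le_one) s
  refine (mul_le_mul_right h1 _).trans ?_
  rw [← ENNReal.ofReal_natCast, ← ENNReal.ofReal_mul hl.le]
  refine ENNReal.ofReal_le_ofReal ?_
  have h2 := Nat.floor_le (div_nonneg hlog hl.le)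
  rw [← hN, le_div_iff₀ hl] at h2
  have h3 : Real.log (2 / s) = Real.log 2 + Real.log (1 / s) := by
    rw [← Real.log_mul (by norm_num) (by positivity)]; congr 1; ring
  rw [h3]
  push_cast
  linarith

theorem log_two_mul_tsum_lintegral_derivMajorant_le (f : ℝ → ℂ) (R : ℝ) :
    ENNReal.ofReal (Real.log 2) * ∑' n : ℕ, ∫⁻ s in Ioc (0 : ℝ) ((1 / 2) ^ n), derivMajorant f R s
      ≤ A1 f R := by
  have hmeas := measurable_derivMajorant f R
  have e : ∀ n : ℕ, ∫⁻ s in Ioc (0 : ℝ) ((1 / 2) ^ n), derivMajorant f R s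
      = ∫⁻ s in Ioc (0 : ℝ) 1, derivMajorant f R s *
        (Ioc (0 : ℝ) ((1 / 2) ^ n)).indicator (fun _ => 1) s := by
    intro n
    have hsub : Ioc (0 : ℝ) ((1 / 2) ^ n) ⊆ Ioc 0 1 :=
      Ioc_subset_Ioc_right (pow_le_one₀ (by norm_num) (by norm_num))
    rw [← inter_eq_self_of_subset_left hsub, ← Measure.restrict_restrict measurableSet_Ioc,
      ← lintegral_indicator measurableSet_Ioc]
    refine lintegral_congr fun s => ?_
    rw [inter_eq_self_of_subset_left hsub]
    simp [indicator]
  simp_rw [e]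
  have hM : ∀ n : ℕ, AEMeasurable (fun s => derivMajorant f R s *
      (Ioc (0 : ℝ) ((1 / 2) ^ n)).indicator (fun _ => 1) s) (volume.restrict (Ioc 0 1)) :=
    fun n => (Measurable.mul hmeas (measurable_const.indicator measurableSet_Ioc)).aemeasurable
  rw [← lintegral_tsum hM]
  simp_rw [ENNReal.tsum_mul_left]
  rw [← lintegral_const_mul' _ _ ENNReal.ofReal_ne_top, A1]
  refine setLIntegral_mono' measurableSet_Ioc fun s hs => ?_
  rw [mul_left_comm]
  exact mul_le_mul_right (log_two_mul_tsum_indicator_le hs.1 hs.2) _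

/-- The integral condition as a statement on a real majorant `m` of the derivative and its
primitive `F`. -/
theorem exists_majorant_of_A1_lt_top {f : ℝ → ℂ} (h : A1 f 1 < ⊤) :
    ∃ m F : ℝ → ℝ, (∀ t, 0 ≤ m t) ∧ (∀ t, 0 ≤ F t) ∧
      (∀ a, 0 < a → ∀ᵐ s : ℝ, a ≤ |s| ∧ |s| ≤ 1 → ‖deriv f s‖ ≤ m a) ∧
      (∀ u v, 0 < u → u ≤ v → v ≤ 1 → m v * (v - u) ≤ F v - F u) ∧
      Summable fun n : ℕ => F ((1 / 2) ^ n) := by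
  refine ⟨fun t => (derivMajorant f 1 t).toReal,
    fun t => (∫⁻ s in Ioc (0 : ℝ) t, derivMajorant f 1 s).toReal, fun t => ENNReal.toReal_nonneg,
    fun t => ENNReal.toReal_nonneg, fun a ha => ?_, fun u v hu huv hv => ?_, ?_⟩
  · filter_upwards [ae_enorm_deriv_le_derivMajorant f 1 a] with s hs hs'
    have := ENNReal.toReal_mono (derivMajorant_lt_top h ha).ne (hs hs')
    simpa using this
  · have hle : ∀ w ≤ (1 : ℝ), ∫⁻ s in Ioc (0 : ℝ) w, derivMajorant f 1 s ≠ ⊤ := fun w hw =>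
      ((lintegral_mono_set (Ioc_subset_Ioc_right hw)).trans_lt
        (lintegral_derivMajorant_lt_top h)).ne
    have hsplit : ∫⁻ s in Ioc (0 : ℝ) v, derivMajorant f 1 s
        = (∫⁻ s in Ioc (0 : ℝ) u, derivMajorant f 1 s)
          + ∫⁻ s in Ioc u v, derivMajorant f 1 s := by
      rw [← lintegral_union measurableSet_Ioc (Ioc_disjoint_Ioc_of_le le_rfl),
        Ioc_union_Ioc_eq_Ioc hu.le huv]
    have h2 : ∫⁻ s in Ioc u v, derivMajorant f 1 s ≠ ⊤ :=
      ((lintegral_mono_set (Ioc_subset_Ioc_left hu.le)).trans_lt (hle v hv).lt_top).ne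
    have h1 := ENNReal.toReal_mono h2 (ofReal_sub_mul_derivMajorant_le f 1 u v)
    rw [ENNReal.toReal_mul, ENNReal.toReal_ofReal (by linarith)] at h1
    simp only
    rw [hsplit, ENNReal.toReal_add (hle u (huv.trans hv)) h2]
    linarith
  · refine ENNReal.summable_toReal fun h2 => ?_
    have h1 := (log_two_mul_tsum_lintegral_derivMajorant_le f 1).trans_lt h
    rw [h2, ENNReal.mul_top (by simpa using Real.log_pos one_lt_two)] at h1
    exact h1.ne rfl

/-- The sign `σ` selects a half-line, so that both are treated at once. -/
theorem norm_sub_le_of_ae_norm_deriv_le {f : ℝ → ℂ} (hf : LocallyACOffZero f) {a b C σ : ℝ}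
    (hσ : σ = 1 ∨ σ = -1) (ha : 0 < a)
    (hC : ∀ᵐ s : ℝ, a ≤ |s| ∧ |s| ≤ b → ‖deriv f s‖ ≤ C) {x y : ℝ} (hx : x ∈ Icc a b)
    (hy : y ∈ Icc a b) : ‖f (σ * x) - f (σ * y)‖ ≤ C * |x - y| := by
  have hab : a ≤ b := hx.1.trans hx.2
  rcases hσ with rfl | rfl
  · rw [one_mul, one_mul]
    refine (hf a b hab fun h0 => ha.not_ge h0.1).norm_sub_le_of_ae_norm_deriv_le hab ?_ hx hy
    filter_upwards [hC] with s hs hm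
    have : |s| = s := abs_of_pos (ha.trans_le hm.1)
    exact hs ⟨by rw [this]; exact hm.1, by rw [this]; exact hm.2⟩
  · have := (hf (-b) (-a) (by linarith) fun h0 => by linarith [h0.2]).norm_sub_le_of_ae_norm_deriv_le
      (D := C) (by linarith) (by
        filter_upwards [hC] with s hs hm
        have : |s| = -s := abs_of_neg (by linarith [hm.2])
        exact hs ⟨by rw [this]; linarith [hm.2], by rw [this]; linarith [hm.1]⟩)
      (x := -x) (y := -y) ⟨by linarith [hx.2], by linarith [hx.1]⟩
      ⟨by linarith [hy.2], by linarith [hy.1]⟩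
    rw [neg_one_mul, neg_one_mul]
    rwa [show -x - -y = -(x - y) by ring, abs_neg] at this

/-- Absolute continuity is not available up to `0`, so the increment is telescoped along `t, t/2,
t/4, …` and the limit uses continuity. One step costs at most `m (x/2) * (x/2)`, which is twice `m
(x/2) * (x/2 - x/4)` and hence at most `2 * (F (x/2) - F (x/4))`. -/
theorem norm_sub_apply_zero_le {f : ℝ → ℂ} (hf : LocallyACOffZero f) (hc : Continuous f)
    {m F : ℝ → ℝ} (hF : ∀ t, 0 ≤ F t)
    (hm : ∀ a, 0 < a → ∀ᵐ s : ℝ, a ≤ |s| ∧ |s| ≤ 1 → ‖deriv f s‖ ≤ m a)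
    (hmF : ∀ u v, 0 < u → u ≤ v → v ≤ 1 → m v * (v - u) ≤ F v - F u) {σ t : ℝ}
    (hσ : σ = 1 ∨ σ = -1) (ht : 0 < t) (ht1 : t ≤ 1) :
    ‖f (σ * t) - f 0‖ ≤ 2 * F (t / 2) := by
  have hstep : ∀ x, 0 < x → x ≤ 1 →
      ‖f (σ * x) - f (σ * (x / 2))‖ ≤ 2 * (F (x / 2) - F (x / 2 / 2)) := by
    intro x hx hx1
    have h1 := norm_sub_le_of_ae_norm_deriv_le hf hσ (half_pos hx) (hm _ (half_pos hx))
      (x := x) (y := x / 2) ⟨by linarith, hx1⟩ ⟨le_rfl, by linarith⟩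
    rw [abs_of_nonneg (by linarith)] at h1
    have h2 := hmF (x / 2 / 2) (x / 2) (by linarith) (by linarith) (by linarith)
    linarith
  have hind : ∀ N : ℕ, ‖f (σ * t) - f (σ * (t * (1 / 2) ^ N))‖
      ≤ 2 * (F (t / 2) - F (t * (1 / 2) ^ N / 2)) := by
    intro N
    induction N with
    | zero => simp
    | succ N ih =>
      have hq : (1 / 2 : ℝ) ^ N ≤ 1 := pow_le_one₀ (by norm_num) (by norm_num)
      have hq0 : (0 : ℝ) < (1 / 2) ^ N := by positivity
      have h1 := hstep (t * (1 / 2) ^ N) (by positivity) (by nlinarith)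
      have e : t * (1 / 2 : ℝ) ^ (N + 1) = t * (1 / 2) ^ N / 2 := by rw [pow_succ]; ring
      rw [e]
      have := norm_sub_le_norm_sub_add_norm_sub (f (σ * t)) (f (σ * (t * (1 / 2) ^ N)))
        (f (σ * (t * (1 / 2) ^ N / 2)))
      linarith
  have hlim : Tendsto (fun N : ℕ => ‖f (σ * t) - f (σ * (t * (1 / 2) ^ N))‖) atTop
      (𝓝 ‖f (σ * t) - f 0‖) := by
    have h1 : Tendsto (fun N : ℕ => σ * (t * (1 / 2 : ℝ) ^ N)) atTop (𝓝 (σ * (t * 0))) :=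
      ((tendsto_pow_atTop_nhds_zero_of_lt_one (by norm_num) (by norm_num)).const_mul t).const_mul σ
    rw [mul_zero, mul_zero] at h1
    exact (tendsto_const_nhds.sub ((hc.tendsto 0).comp h1)).norm
  exact le_of_tendsto' hlim fun N => (hind N).trans (by linarith [hF (t * (1 / 2) ^ N / 2)])

/-! ### Uniform power bounds away from the origin. -/

/-- Lets a constant bound on a compact range be absorbed into a power bound valid at infinity. -/
theorem exists_one_le_mul_rpow (γ R : ℝ) :
    ∃ M : ℝ, 0 ≤ M ∧ ∀ x ∈ Icc (1 / 2) R, 1 ≤ M * x ^ γ := by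
  have hc : ContinuousOn (fun x : ℝ => x ^ (-γ)) (Icc (1 / 2) R) := fun x hx =>
    (Real.continuousAt_rpow_const x (-γ) (Or.inl (by linarith [hx.1]))).continuousWithinAt
  obtain ⟨M, hM⟩ := isCompact_Icc.exists_bound_of_continuousOn hc
  refine ⟨|M|, abs_nonneg M, fun x hx => ?_⟩
  have hx0 : 0 < x := by linarith [hx.1]
  have h1 := ((le_abs_self _).trans (hM x hx)).trans (le_abs_self M)
  rw [Real.rpow_neg hx0.le] at h1
  exact (inv_le_iff_one_le_mul₀ (by positivity)).1 h1

theorem exists_eventually_cocompact {P : ℝ → Prop} (h : ∀ᶠ t in cocompact ℝ, P t) :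
    ∃ R : ℝ, ∀ t, R < |t| → P t := by
  rw [← Metric.cobounded_eq_cocompact, hasBasis_cobounded_norm.eventually_iff] at h
  obtain ⟨R, -, hR⟩ := h
  exact ⟨R, fun t ht => hR ht.le⟩

theorem DecayHypotheses.exists_norm_le {f : ℝ → ℂ} {α β : ℝ} (h : DecayHypotheses f α β) :
    ∃ C : ℝ, 0 ≤ C ∧ ∀ t, 1 / 2 ≤ |t| → ‖f t‖ ≤ C * |t| ^ (-α) := by
  obtain ⟨c, hc⟩ := h.isBigO.bound
  obtain ⟨R, hR⟩ := exists_eventually_cocompact hc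
  obtain ⟨B, hB⟩ := (isCompact_Icc (a := -R) (b := R)).exists_bound_of_continuousOn
    h.isC0.1.continuousOn
  obtain ⟨M, hM0, hM⟩ := exists_one_le_mul_rpow (-α) R
  refine ⟨|c| + |B| * M, by positivity, fun t ht => ?_⟩
  have hp : 0 ≤ |t| ^ (-α) := by positivity
  rw [add_mul]
  rcases lt_or_ge R |t| with hRt | hRt
  · have := hR t hRt
    rw [Real.norm_of_nonneg hp] at this
    have h1 : c * |t| ^ (-α) ≤ |c| * |t| ^ (-α) := by gcongr; exact le_abs_self c
    have h2 : 0 ≤ |B| * M * |t| ^ (-α) := by positivity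
    linarith
  · have h1 := (hB t (abs_le.1 hRt)).trans (le_abs_self B)
    have h2 : |B| * 1 ≤ |B| * (M * |t| ^ (-α)) := by gcongr; exact hM _ ⟨ht, hRt⟩
    have h3 : 0 ≤ |c| * |t| ^ (-α) := by positivity
    linarith

theorem DecayHypotheses.exists_ae_norm_deriv_le {f : ℝ → ℂ} {α β γ : ℝ}
    (h : DecayHypotheses f α β) (hγ : γ ≤ β) :
    ∃ C : ℝ, 0 ≤ C ∧ ∀ᵐ t : ℝ, 1 / 2 ≤ |t| → ‖deriv f t‖ ≤ C * |t| ^ (-γ) := by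
  obtain ⟨c, hc⟩ := h.deriv_isBigO.bound
  obtain ⟨s₁, hs₁, s₂, hs₂, hs⟩ := mem_inf_iff_superset.1 hc
  obtain ⟨R₀, hR₀⟩ := exists_eventually_cocompact hs₁
  -- Beyond `1` the bound with exponent `β` implies the one with `γ ≤ β`; on `1/2 ≤ |t| ≤ R` the
  -- finite majorant serves instead.
  set R := max R₀ 1 with hRdef
  obtain ⟨M, hM0, hM⟩ := exists_one_le_mul_rpow (-γ) R
  set B := (derivMajorant f R (1 / 2)).toReal with hBdef
  have hB0 : 0 ≤ B := ENNReal.toReal_nonneg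
  have hB : ∀ᵐ s : ℝ, 1 / 2 ≤ |s| ∧ |s| ≤ R → ‖deriv f s‖ ≤ B := by
    filter_upwards [ae_enorm_deriv_le_derivMajorant f R (1 / 2)] with s hs hs'
    have := ENNReal.toReal_mono (derivMajorant_lt_top (h.A1_lt_top R) (by norm_num)).ne (hs hs')
    simpa [hBdef] using this
  refine ⟨|c| + B * M, by positivity, ?_⟩
  filter_upwards [hB, hs₂] with t hBt h2t ht
  have hp : 0 ≤ |t| ^ (-γ) := by positivity
  rw [add_mul]
  rcases lt_or_ge R |t| with hRt | hRt
  · have h0 : ‖deriv f t‖ ≤ c * ‖|t| ^ (-β)‖ :=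
      hs ⟨hR₀ t ((le_max_left _ _).trans_lt hRt), h2t⟩
    have h1t : 1 ≤ |t| := (le_max_right _ _).trans hRt.le
    rw [Real.norm_of_nonneg (by positivity)] at h0
    have h1 : c * |t| ^ (-β) ≤ |c| * |t| ^ (-γ) := by
      gcongr
      exact le_abs_self c
    have h2 : 0 ≤ B * M * |t| ^ (-γ) := by positivity
    linarith
  · have h1 := hBt ⟨ht, hRt⟩
    have h2 : B * 1 ≤ B * (M * |t| ^ (-γ)) := by gcongr; exact hM _ ⟨ht, hRt⟩
    have h3 : 0 ≤ |c| * |t| ^ (-γ) := by positivity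
    linarith

/-! ### Membership in `A(ℝ)` when `α + β > 1`. -/

/-- The tent `max 0 (1 - |t|)`. -/
def tent (t : ℝ) : ℝ := max 0 (1 - |t|)

theorem abs_tent_sub_le (s t : ℝ) : |tent s - tent t| ≤ |s - t| := by
  unfold tent
  refine (abs_max_sub_max_le_max _ _ _ _).trans ?_
  rw [sub_self, abs_zero]
  refine max_le (abs_nonneg _) ?_
  rw [show 1 - |s| - (1 - |t|) = -(|s| - |t|) by ring, abs_neg]
  exact abs_abs_sub_abs_le _ _

theorem tent_nonneg (t : ℝ) : 0 ≤ tent t := le_max_left _ _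

theorem tent_le_one (t : ℝ) : tent t ≤ 1 := max_le zero_le_one (by linarith [abs_nonneg t])

theorem tent_eq_zero {t : ℝ} (ht : 1 ≤ |t|) : tent t = 0 := max_eq_left (by linarith)

theorem tent_eq_one_sub {t : ℝ} (ht : 0 ≤ t) (ht1 : t ≤ 1) : tent t = 1 - t := by
  rw [tent, abs_of_nonneg ht, max_eq_right (by linarith)]

theorem norm_ofReal_tent (t : ℝ) : ‖(tent t : ℂ)‖ = tent t := by
  rw [Complex.norm_real, Real.norm_of_nonneg (tent_nonneg t)]

theorem memFourierA_tent : MemFourierA fun t => (tent t : ℂ) := by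
  obtain ⟨g, hg, hgr, -⟩ := exists_rep_of_lipschitz (h := fun t => (tent t : ℂ)) (a := -1) (b := 1)
    (S := 1) (D := 1) (by norm_num)
    (LipschitzOnWith.of_dist_le_mul fun t _ s _ => by
      rw [dist_eq_norm, Real.dist_eq, ← Complex.ofReal_sub, Complex.norm_real]
      simpa using abs_tent_sub_le t s)
    one_pos one_pos (fun t _ => by rw [norm_ofReal_tent]; exact tent_le_one t)
    (fun t ht => by
      have : 1 ≤ |t| := by
        by_contra h
        exact ht (abs_lt.1 (not_le.1 h))
      simp [tent_eq_zero this])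
  exact ⟨g, hg, hgr⟩

theorem rpow_neg_le_of_mem_dyadic (γ : ℝ) (n : ℕ) {x : ℝ}
    (hx : x ∈ Icc ((2 : ℝ) ^ n / 2) (2 ^ n * 2)) :
    x ^ (-γ) ≤ 2 ^ |γ| * ((2 : ℝ) ^ n) ^ (-γ) := by
  have hp : (0 : ℝ) < 2 ^ n := by positivity
  have hx0 : 0 < x := by linarith [hx.1]
  set u := x / 2 ^ n with hu
  have hu0 : 0 < u := by positivity
  have hxu : x = u * 2 ^ n := by rw [hu]; field_simp
  rw [hxu, Real.mul_rpow hu0.le hp.le]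
  gcongr
  have hu1 : 1 / 2 ≤ u := (le_div_iff₀ hp).2 (by linarith [hx.1])
  have hu2 : u ≤ 2 := (div_le_iff₀ hp).2 (by linarith [hx.2])
  rcases le_total 0 γ with h | h
  · rw [abs_of_nonneg h]
    calc u ^ (-γ) ≤ (1 / 2) ^ (-γ) := Real.rpow_le_rpow_of_nonpos (by norm_num) hu1 (by linarith)
      _ = 2 ^ γ := by rw [one_div, Real.inv_rpow (by norm_num), Real.rpow_neg (by norm_num), inv_inv]
  · rw [abs_of_nonpos h]
    exact Real.rpow_le_rpow hu0.le hu2 (by linarith)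

/-- The part of `f - f 0 * tent` on the half-line `σ * (0, ∞)`, moved to `(0, ∞)`. -/
noncomputable def halfLinePart (f : ℝ → ℂ) (σ t : ℝ) : ℂ :=
  if t ≤ 0 then 0 else f (σ * t) - f 0 * (tent t : ℂ)

theorem halfLinePart_of_pos (f : ℝ → ℂ) (σ : ℝ) {t : ℝ} (ht : 0 < t) :
    halfLinePart f σ t = f (σ * t) - f 0 * (tent t : ℂ) := if_neg ht.not_ge

theorem norm_halfLinePart_sub_le {f : ℝ → ℂ} (hf : LocallyACOffZero f) {a b C σ : ℝ}
    (hσ : σ = 1 ∨ σ = -1) (ha : 0 < a)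
    (hC : ∀ᵐ s : ℝ, a ≤ |s| ∧ |s| ≤ b → ‖deriv f s‖ ≤ C) {x y : ℝ} (hx : x ∈ Icc a b)
    (hy : y ∈ Icc a b) :
    ‖halfLinePart f σ x - halfLinePart f σ y‖ ≤ C * |x - y| + ‖f 0‖ * |tent x - tent y| := by
  rw [halfLinePart_of_pos f σ (ha.trans_le hx.1), halfLinePart_of_pos f σ (ha.trans_le hy.1)]
  have e : f (σ * x) - f 0 * (tent x : ℂ) - (f (σ * y) - f 0 * (tent y : ℂ))
      = (f (σ * x) - f (σ * y)) - f 0 * ((tent x - tent y : ℝ) : ℂ) := by push_cast; ring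
  rw [e]
  refine (norm_sub_le _ _).trans ?_
  rw [norm_mul, Complex.norm_real, Real.norm_eq_abs]
  gcongr
  exact norm_sub_le_of_ae_norm_deriv_le hf hσ ha hC hx hy

/-- Only `n = 0` sees the support of the tent, and there the power equals `1` whatever the exponent.
-/
theorem tent_le_dyadic {α : ℝ} {n : ℕ} {x : ℝ} (hx : x ∈ Icc ((2 : ℝ) ^ n / 2) (2 ^ n * 2)) :
    tent x ≤ ((2 : ℝ) ^ n) ^ (-α) := by
  rcases n with _ | n
  · simpa using tent_le_one x
  · rw [tent_eq_zero]
    · positivity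
    · have h1 : (1 : ℝ) ≤ 2 ^ n := one_le_pow₀ one_le_two
      have h2 := hx.1
      rw [pow_succ] at h2
      exact le_trans (by linarith) (le_abs_self x)

theorem abs_tent_sub_le_dyadic {γ : ℝ} {n : ℕ} {x y : ℝ}
    (hx : x ∈ Icc ((2 : ℝ) ^ n / 2) (2 ^ n * 2)) (hy : y ∈ Icc ((2 : ℝ) ^ n / 2) (2 ^ n * 2)) :
    |tent x - tent y| ≤ ((2 : ℝ) ^ n) ^ (-γ) * |x - y| := by
  rcases n with _ | n
  · simpa using abs_tent_sub_le x y
  · have h1 : (1 : ℝ) ≤ 2 ^ n := one_le_pow₀ one_le_two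
    have hx1 := hx.1
    have hy1 := hy.1
    rw [pow_succ] at hx1 hy1
    rw [tent_eq_zero (le_trans (by linarith) (le_abs_self x)),
      tent_eq_zero (le_trans (by linarith) (le_abs_self y)), sub_self, abs_zero]
    positivity

theorem DecayHypotheses.memFourierA_halfLinePart {f : ℝ → ℂ} {α β σ : ℝ}
    (h : DecayHypotheses f α β) (hα : 0 < α) (hαβ : 1 < α + β) (hσ : σ = 1 ∨ σ = -1) :
    MemFourierA (halfLinePart f σ) := by
  obtain ⟨m, F, hm0, hF0, hm, hmF, hFs⟩ := exists_majorant_of_A1_lt_top (h.A1_lt_top 1)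
  -- Capping `β` at `1` ensures `S k ≤ E k` at infinity, and `α + γ > 1` survives because `α > 0`.
  set γ := min β 1 with hγ
  have hγ1 : γ ≤ 1 := min_le_right _ _
  have hαγ : 1 < α + γ := by
    rcases min_choice β 1 with h' | h' <;> rw [hγ, h'] <;> linarith
  obtain ⟨C, hC0, hC⟩ := h.exists_norm_le
  obtain ⟨D, hD0, hD⟩ := h.exists_ae_norm_deriv_le (min_le_left β 1)
  rw [← hγ] at hD
  have hσa : |σ| = 1 := by rcases hσ with rfl | rfl <;> simp
  set K := C * 2 ^ |α| + D * 2 ^ |γ| + ‖f 0‖ + 1 with hK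
  have hK0 : 0 < K := by positivity
  -- One bound for both size and scaled slope. The slope needs the `4`: with left endpoint `v` it
  -- gives `2 * v * m v`, at most `4 * (F v - F (v / 2))`. The tent gives `‖f 0‖`, and the extra `1`
  -- keeps `G` positive.
  set G : ℕ → ℝ := fun n => 4 * F ((1 / 2) ^ n) + (‖f 0‖ + 1) * (1 / 2) ^ n with hG
  have hG0 : ∀ n, 0 < G n := fun n => by have := hF0 ((1 / 2) ^ n); positivity
  have hGs : Summable G := (hFs.mul_left 4).add
    ((summable_geometric_of_lt_one (by norm_num) (by norm_num)).mul_left _)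
  have hFmono : ∀ u v, 0 < u → u ≤ v → v ≤ 1 → F u ≤ F v := fun u v hu huv hv => by
    have := hmF u v hu huv hv
    have := mul_nonneg (hm0 v) (sub_nonneg.2 huv)
    linarith
  -- `Int.negSucc n` is `k = -(n + 1)`, whose interval ends at `2 ^ (k + 1) = (1 / 2) ^ n`, the
  -- argument of `F` in `G n`.
  set S : ℤ → ℝ := fun k => Int.casesOn k (fun n => K * ((2 : ℝ) ^ n) ^ (-α)) G with hS
  set E : ℤ → ℝ := fun k => Int.casesOn k (fun n => K * ((2 : ℝ) ^ n) ^ (1 - γ)) G with hE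
  have pow_negSucc : ∀ n : ℕ, (2 : ℝ) ^ (Int.negSucc n) = (1 / 2) ^ n / 2 := fun n => by
    rw [zpow_negSucc, pow_succ, one_div_pow]; field_simp
  refine MemFourierA.of_dyadic (S := S) (E := E) (fun t ht => if_pos ht) ?_ ?_ ?_ ?_ ?_
  · rintro (n | n)
    · have : (0 : ℝ) < ((2 : ℝ) ^ n) ^ (-α) := by positivity
      exact mul_pos hK0 this
    · exact hG0 n
  · rintro (n | n)
    · refine mul_le_mul_of_nonneg_left ?_ hK0.le
      exact Real.rpow_le_rpow_of_exponent_le (one_le_pow₀ one_le_two) (by linarith)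
    · exact le_rfl
  · refine Summable.of_nat_of_neg_add_one ?_ ?_
    · have hr : ∀ n : ℕ, √(S n * E n) = K * ((2 : ℝ) ^ ((1 - α - γ) / 2)) ^ n := by
        intro n
        have hp : (0 : ℝ) < 2 ^ n := by positivity
        have e : S n * E n = (K * ((2 : ℝ) ^ ((1 - α - γ) / 2)) ^ n) ^ 2 := by
          change K * ((2 : ℝ) ^ n) ^ (-α) * (K * ((2 : ℝ) ^ n) ^ (1 - γ)) = _
          rw [← Real.rpow_natCast_mul (by norm_num), ← Real.rpow_natCast_mul (by norm_num),
            ← Real.rpow_mul_natCast (by norm_num), mul_pow, ← Real.rpow_mul_natCast (by norm_num),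
            mul_mul_mul_comm, ← Real.rpow_add (by norm_num), ← sq]
          congr 2
          push_cast
          ring
        rw [e, Real.sqrt_sq (by positivity)]
      simp_rw [hr]
      refine (summable_geometric_of_lt_one (by positivity) ?_).mul_left _
      exact Real.rpow_lt_one_of_one_lt_of_neg one_lt_two (by linarith)
    · have e : ∀ n : ℕ, √(S (-(n + 1 : ℤ)) * E (-(n + 1 : ℤ))) = G n := by
        intro n
        rw [show (-(n + 1 : ℤ)) = Int.negSucc n from (Int.negSucc_eq n).symm]
        exact Real.sqrt_mul_self (hG0 n).le
      simpa only [e] using hGs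
  · rintro (n | n) t ht
    · rw [zpow_sub_one₀ two_ne_zero, zpow_add_one₀ two_ne_zero, Int.ofNat_eq_natCast,
        zpow_natCast, ← div_eq_mul_inv] at ht
      have hp : (1 : ℝ) ≤ 2 ^ n := one_le_pow₀ one_le_two
      have ht0 : 0 < t := by linarith [ht.1]
      have hta : |σ * t| = t := by rw [abs_mul, hσa, one_mul, abs_of_pos ht0]
      rw [halfLinePart_of_pos f σ ht0]
      refine (norm_sub_le _ _).trans ?_
      rw [norm_mul, norm_ofReal_tent]
      have h1 := hC (σ * t) (by rw [hta]; linarith [ht.1])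
      rw [hta] at h1
      have h2 : C * t ^ (-α) ≤ C * (2 ^ |α| * ((2 : ℝ) ^ n) ^ (-α)) := by
        gcongr; exact rpow_neg_le_of_mem_dyadic α n ht
      have h3 : ‖f 0‖ * tent t ≤ ‖f 0‖ * ((2 : ℝ) ^ n) ^ (-α) := by
        gcongr; exact tent_le_dyadic ht
      have hp0 : (0 : ℝ) ≤ ((2 : ℝ) ^ n) ^ (-α) := by positivity
      have h4 : 0 ≤ (D * 2 ^ |γ| + 1) * ((2 : ℝ) ^ n) ^ (-α) := by positivity
      change _ ≤ K * ((2 : ℝ) ^ n) ^ (-α)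
      rw [hK]
      linarith
    · rw [zpow_sub_one₀ two_ne_zero, zpow_add_one₀ two_ne_zero, pow_negSucc] at ht
      have hq0 : (0 : ℝ) < (1 / 2) ^ n := by positivity
      have hq : (1 / 2 : ℝ) ^ n ≤ 1 := pow_le_one₀ (by norm_num) (by norm_num)
      have ht0 : 0 < t := by linarith [ht.1]
      have ht1 : t ≤ (1 / 2) ^ n := by linarith [ht.2]
      rw [halfLinePart_of_pos f σ ht0, tent_eq_one_sub ht0.le (ht1.trans hq)]
      have e : f (σ * t) - f 0 * ((1 - t : ℝ) : ℂ) = (f (σ * t) - f 0) + f 0 * (t : ℂ) := by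
        push_cast; ring
      rw [e]
      refine (norm_add_le _ _).trans ?_
      rw [norm_mul, Complex.norm_real, Real.norm_of_nonneg ht0.le]
      have h1 := norm_sub_apply_zero_le h.locallyAC h.isC0.1 hF0 hm hmF hσ ht0 (ht1.trans hq)
      have h2 := hFmono (t / 2) ((1 / 2) ^ n) (by linarith) (by linarith) hq
      have h3 : ‖f 0‖ * t ≤ ‖f 0‖ * (1 / 2) ^ n := by gcongr
      have h4 := hF0 ((1 / 2) ^ n)
      change _ ≤ 4 * F ((1 / 2) ^ n) + (‖f 0‖ + 1) * (1 / 2) ^ n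
      linarith
  · rintro (n | n) t ht s hs
    · rw [zpow_sub_one₀ two_ne_zero, zpow_add_one₀ two_ne_zero, Int.ofNat_eq_natCast,
        zpow_natCast, ← div_eq_mul_inv] at ht hs
      have hp : (1 : ℝ) ≤ 2 ^ n := one_le_pow₀ one_le_two
      have h1 := norm_halfLinePart_sub_le h.locallyAC hσ (a := 2 ^ n / 2) (b := 2 ^ n * 2)
        (C := D * (2 ^ |γ| * ((2 : ℝ) ^ n) ^ (-γ))) (by positivity) (by
          filter_upwards [hD] with x hx hm
          refine (hx (by linarith [hm.1])).trans ?_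
          gcongr
          exact rpow_neg_le_of_mem_dyadic γ n hm) ht hs
      have h2 : ‖f 0‖ * |tent t - tent s| ≤ ‖f 0‖ * (((2 : ℝ) ^ n) ^ (-γ) * |t - s|) := by
        gcongr; exact abs_tent_sub_le_dyadic ht hs
      have e : E (Int.ofNat n) / 2 ^ (Int.ofNat n) = K * ((2 : ℝ) ^ n) ^ (-γ) := by
        change K * ((2 : ℝ) ^ n) ^ (1 - γ) / 2 ^ (Int.ofNat n) = _
        rw [Int.ofNat_eq_natCast, zpow_natCast, sub_eq_add_neg, Real.rpow_add (by positivity),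
          Real.rpow_one]
        field_simp
      rw [e, hK]
      have h3 : 0 ≤ (C * 2 ^ |α| + 1) * (((2 : ℝ) ^ n) ^ (-γ) * |t - s|) := by positivity
      linarith
    · rw [zpow_sub_one₀ two_ne_zero, zpow_add_one₀ two_ne_zero, pow_negSucc] at ht hs
      have hq0 : (0 : ℝ) < (1 / 2) ^ n := by positivity
      have hq : (1 / 2 : ℝ) ^ n ≤ 1 := pow_le_one₀ (by norm_num) (by norm_num)
      set v : ℝ := (1 / 2) ^ n / 2 * 2⁻¹ with hv
      have hv0 : 0 < v := by positivity
      have hvq : (1 / 2 : ℝ) ^ n = 4 * v := by rw [hv]; ring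
      have h1 := norm_halfLinePart_sub_le h.locallyAC hσ (a := v) (b := (1 / 2) ^ n / 2 * 2)
        (C := m v) hv0 (by
          filter_upwards [hm v hv0] with x hx hm'
          exact hx ⟨hm'.1, by linarith [hm'.2]⟩) ht hs
      have h2 : ‖f 0‖ * |tent t - tent s| ≤ ‖f 0‖ * |t - s| :=
        mul_le_mul_of_nonneg_left (abs_tent_sub_le t s) (norm_nonneg _)
      have h3 := hmF (v / 2) v (by linarith) (by linarith) (by linarith)
      have h4 := hFmono v (4 * v) hv0 (by linarith) (by linarith)
      have h5 := hF0 (v / 2)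
      have h6 := hm0 v
      have hslope : m v + ‖f 0‖ ≤ E (Int.negSucc n) / 2 ^ (Int.negSucc n) := by
        rw [pow_negSucc, le_div_iff₀ (by positivity)]
        change _ ≤ 4 * F ((1 / 2) ^ n) + (‖f 0‖ + 1) * (1 / 2) ^ n
        rw [hvq]
        have h7 : 0 ≤ ‖f 0‖ * v := by positivity
        linarith
      calc _ ≤ m v * |t - s| + ‖f 0‖ * |t - s| := h1.trans (by linarith)
        _ = (m v + ‖f 0‖) * |t - s| := by ring
        _ ≤ _ := by gcongr

theorem DecayHypotheses.memFourierA {f : ℝ → ℂ} {α β : ℝ} (h : DecayHypotheses f α β)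
    (hα : 0 < α) (hαβ : 1 < α + β) : MemFourierA f := by
  have h1 := h.memFourierA_halfLinePart hα hαβ (Or.inl rfl)
  have h2 := (h.memFourierA_halfLinePart hα hαβ (Or.inr rfl)).comp_neg
  have h3 := (h1.add h2).add (memFourierA_tent.const_mul (f 0))
  convert h3 using 1
  ext t
  rcases lt_trichotomy t 0 with ht | rfl | ht
  · have : tent (-t) = tent t := by simp [tent]
    rw [halfLinePart, if_pos ht.le, halfLinePart_of_pos f _ (neg_pos.2 ht), this]
    simp
  · simp [halfLinePart, tent]
  · rw [halfLinePart_of_pos f _ ht, halfLinePart, if_pos (by linarith)]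
    simp

/-! ### Oscillatory integrals. -/

/-- Van der Corput's second derivative estimate. -/
theorem norm_integral_exp_I_le_of_le_deriv {φ u u' : ℝ → ℝ} {A B l : ℝ} (hAB : A ≤ B) (hl : 0 < l)
    (hφ : ∀ t ∈ Icc A B, HasDerivAt φ (u t) t) (hu : ∀ t ∈ Icc A B, HasDerivAt u (u' t) t)
    (hu' : ContinuousOn u' (Icc A B)) (hlu : ∀ t ∈ Icc A B, l ≤ u' t) :
    ‖∫ t in A..B, Complex.exp (Complex.I * (φ t : ℂ))‖ ≤ 8 / √l := by
  have hI : uIcc A B = Icc A B := uIcc_of_le hAB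
  have hφc : ContinuousOn φ (Icc A B) := fun t ht => (hφ t ht).continuousAt.continuousWithinAt
  have huc : ContinuousOn u (Icc A B) := fun t ht => (hu t ht).continuousAt.continuousWithinAt
  have hs : 0 < √l := Real.sqrt_pos.2 hl
  have hss : √l ^ 2 = l := Real.sq_sqrt hl.le
  have hq : ∀ t, 0 < u t ^ 2 + l := fun t => by positivity
  have hec : ContinuousOn (fun t => Complex.exp (Complex.I * (φ t : ℂ))) (Icc A B) :=
    (continuousOn_const.mul (Complex.continuous_ofReal.comp_continuousOn hφc)).cexp
  -- A regularisation of `1 / u`, so that integration by parts needs no separate treatment of the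
  -- stationary point. The error `e^{iφ} - W'` is at most `2 u' / (u² + l)`, the derivative of the
  -- arctangent `V`.
  set r : ℝ → ℝ := fun t => u t / (u t ^ 2 + l) with hr
  set r' : ℝ → ℝ := fun t => (l - u t ^ 2) / (u t ^ 2 + l) ^ 2 * u' t with hr'
  have hrd : ∀ t ∈ Icc A B, HasDerivAt r (r' t) t := by
    intro t ht
    have := (hu t ht).div (((hu t ht).pow 2).add_const l) (hq t).ne'
    refine this.congr_deriv ?_
    have hq' := (hq t).ne'
    simp only [hr', Pi.pow_apply, Nat.add_one_sub_one, pow_one]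
    field_simp
    push_cast
    ring
  have hr'c : ContinuousOn r' (Icc A B) :=
    ((continuousOn_const.sub (huc.pow 2)).div (((huc.pow 2).add continuousOn_const).pow 2)
      fun t _ => pow_ne_zero 2 (hq t).ne').mul hu'
  have hrb : ∀ t, |r t| ≤ (2 * √l)⁻¹ := by
    intro t
    rw [hr, abs_div, abs_of_pos (hq t), div_le_iff₀ (hq t), inv_mul_eq_div,
      le_div_iff₀ (by positivity)]
    nlinarith [sq_nonneg (|u t| - √l), sq_abs (u t)]
  set W : ℝ → ℂ := fun t => -Complex.I * (r t : ℂ) * Complex.exp (Complex.I * (φ t : ℂ)) with hW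
  set W' : ℝ → ℂ := fun t => (-Complex.I * (r' t : ℂ) + ((u t * r t : ℝ) : ℂ)) *
    Complex.exp (Complex.I * (φ t : ℂ)) with hW'
  have hWd : ∀ t ∈ uIcc A B, HasDerivAt W (W' t) t := by
    intro t ht
    rw [hI] at ht
    have h1 := ((hrd t ht).ofReal_comp).const_mul (-Complex.I)
    have h2 := (((hφ t ht).ofReal_comp).const_mul Complex.I).cexp
    refine (h1.mul h2).congr_deriv ?_
    change _ = (-Complex.I * (r' t : ℂ) + ((u t * r t : ℝ) : ℂ)) *
      Complex.exp (Complex.I * (φ t : ℂ))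
    push_cast
    linear_combination (-(r t : ℂ) * (u t : ℂ) * Complex.exp (Complex.I * (φ t : ℂ))) *
      Complex.I_sq
  have hrc : ContinuousOn r (Icc A B) := fun t ht => (hrd t ht).continuousAt.continuousWithinAt
  have hW'c : ContinuousOn W' (uIcc A B) := by
    rw [hI]
    exact ((continuousOn_const.mul (Complex.continuous_ofReal.comp_continuousOn hr'c)).add
      (Complex.continuous_ofReal.comp_continuousOn (huc.mul hrc))).mul hec
  have hWint := intervalIntegral.integral_eq_sub_of_hasDerivAt hWd hW'c.intervalIntegrable
  set V : ℝ → ℝ := fun t => 2 * (Real.arctan (u t / √l) / √l) with hV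
  have hVd : ∀ t ∈ uIcc A B, HasDerivAt V (2 * (u' t / (u t ^ 2 + l))) t := by
    intro t ht
    rw [hI] at ht
    have := ((((hu t ht).div_const (√l)).arctan).div_const (√l)).const_mul 2
    refine this.congr_deriv ?_
    rw [div_pow, hss]
    field_simp
    rw [hss]
    ring
  have hV'c : ContinuousOn (fun t => 2 * (u' t / (u t ^ 2 + l))) (uIcc A B) := by
    rw [hI]
    exact continuousOn_const.mul (hu'.div ((huc.pow 2).add continuousOn_const) fun t _ => (hq t).ne')
  have hVint := intervalIntegral.integral_eq_sub_of_hasDerivAt hVd hV'c.intervalIntegrable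
  have hsplit : ∫ t in A..B, Complex.exp (Complex.I * (φ t : ℂ))
      = (W B - W A) + ∫ t in A..B, (Complex.exp (Complex.I * (φ t : ℂ)) - W' t) := by
    rw [intervalIntegral.integral_sub (ContinuousOn.intervalIntegrable (by rwa [hI]))
      hW'c.intervalIntegrable, hWint]
    ring
  have hbound : ∀ t ∈ Icc A B,
      ‖Complex.exp (Complex.I * (φ t : ℂ)) - W' t‖ ≤ 2 * (u' t / (u t ^ 2 + l)) := by
    intro t ht
    have e : Complex.exp (Complex.I * (φ t : ℂ)) - W' t
        = (((l / (u t ^ 2 + l) : ℝ) : ℂ) + Complex.I * (r' t : ℂ)) *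
          Complex.exp (Complex.I * (φ t : ℂ)) := by
      have : (1 : ℝ) - u t * r t = l / (u t ^ 2 + l) := by
        have := (hq t).ne'
        simp only [hr]
        field_simp
        ring
      rw [← this, hW']
      push_cast
      ring
    have hup : 0 ≤ u' t := hl.le.trans (hlu t ht)
    have h1 : |r' t| ≤ u' t / (u t ^ 2 + l) := by
      simp only [hr']
      rw [abs_mul, abs_div, abs_of_nonneg hup, abs_of_pos (pow_pos (hq t) 2), div_mul_eq_mul_div,
        div_le_div_iff₀ (pow_pos (hq t) 2) (hq t)]
      have h2 : |l - u t ^ 2| ≤ u t ^ 2 + l :=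
        abs_le.2 ⟨by linarith, by linarith [sq_nonneg (u t)]⟩
      have h3 := mul_le_mul_of_nonneg_right h2 (mul_nonneg hup (hq t).le)
      linarith
    have h2 : l / (u t ^ 2 + l) ≤ u' t / (u t ^ 2 + l) :=
      div_le_div_of_nonneg_right (hlu t ht) (hq t).le
    rw [e, norm_mul_exp_I_mul]
    refine (norm_add_le _ _).trans ?_
    rw [norm_mul, Complex.norm_I, one_mul, Complex.norm_real, Complex.norm_real, Real.norm_eq_abs,
      Real.norm_eq_abs, abs_of_pos (div_pos hl (hq t))]
    linarith
  have hWb : ∀ t, ‖W t‖ ≤ (2 * √l)⁻¹ := fun t => by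
    simp only [hW]
    rw [norm_mul_exp_I_mul, norm_mul, norm_neg, Complex.norm_I, one_mul, Complex.norm_real]
    exact hrb t
  have hint : ‖∫ t in A..B, (Complex.exp (Complex.I * (φ t : ℂ)) - W' t)‖ ≤ V B - V A := by
    rw [← hVint]
    exact intervalIntegral.norm_integral_le_of_norm_le hAB
      (Eventually.of_forall fun t ht => hbound t (Ioc_subset_Icc_self ht)) hV'c.intervalIntegrable
  have hVb : V B - V A ≤ 2 * (Real.pi / √l) := by
    simp only [hV]
    rw [← mul_sub, ← sub_div]
    gcongr
    linarith [Real.arctan_lt_pi_div_two (u B / √l), Real.neg_pi_div_two_lt_arctan (u A / √l)]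
  rw [hsplit]
  calc _ ≤ ‖W B‖ + ‖W A‖ + (V B - V A) :=
        (norm_add_le _ _).trans (add_le_add (norm_sub_le _ _) hint)
    _ ≤ (2 * √l)⁻¹ + (2 * √l)⁻¹ + 2 * (Real.pi / √l) :=
        add_le_add (add_le_add (hWb B) (hWb A)) hVb
    _ = (1 + 2 * Real.pi) / √l := by field_simp; ring
    _ ≤ 8 / √l := by
        gcongr
        linarith [Real.pi_lt_d2]

/-- Changing the sign of the phase conjugates the integral. -/
theorem norm_integral_exp_I_le_of_deriv_le {φ u u' : ℝ → ℝ} {A B l : ℝ} (hAB : A ≤ B) (hl : 0 < l)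
    (hφ : ∀ t ∈ Icc A B, HasDerivAt φ (u t) t) (hu : ∀ t ∈ Icc A B, HasDerivAt u (u' t) t)
    (hu' : ContinuousOn u' (Icc A B)) (hlu : ∀ t ∈ Icc A B, u' t ≤ -l) :
    ‖∫ t in A..B, Complex.exp (Complex.I * (φ t : ℂ))‖ ≤ 8 / √l := by
  have h := norm_integral_exp_I_le_of_le_deriv (φ := fun t => -φ t) hAB hl
    (fun t ht => (hφ t ht).fun_neg) (fun t ht => (hu t ht).fun_neg) hu'.fun_neg
    (fun t ht => by linarith [hlu t ht])
  have e : ∫ t in A..B, Complex.exp (Complex.I * ((-φ t : ℝ) : ℂ))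
      = starRingEnd ℂ (∫ t in A..B, Complex.exp (Complex.I * (φ t : ℂ))) := by
    rw [intervalIntegral.integral_of_le hAB, intervalIntegral.integral_of_le hAB, ← integral_conj]
    refine integral_congr_ae (Eventually.of_forall fun t => ?_)
    simp [← Complex.exp_conj]
  rwa [e, RCLike.norm_conj] at h

theorem rpow_ge_of_mem_dyadic (γ : ℝ) {N t : ℝ} (hN : 0 < N) (ht : t ∈ Icc N (2 * N)) :
    2 ^ (-|γ|) * N ^ γ ≤ t ^ γ := by
  have ht0 : 0 < t := hN.trans_le ht.1
  rcases le_total 0 γ with h | h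
  · have h1 : N ^ γ ≤ t ^ γ := Real.rpow_le_rpow hN.le ht.1 h
    have h2 : (2 : ℝ) ^ (-|γ|) ≤ 1 :=
      Real.rpow_le_one_of_one_le_of_nonpos one_le_two (by simp)
    have h3 : 0 ≤ N ^ γ := by positivity
    nlinarith
  · rw [abs_of_nonpos h, neg_neg, ← Real.mul_rpow (by norm_num) hN.le]
    exact Real.rpow_le_rpow_of_nonpos ht0 ht.2 h

/-- The exponential sums attached to the phase `t ^ a`, `a ≠ 1`, uniformly in the frequency. -/
theorem exists_norm_integral_exp_rpow_le {a : ℝ} (ha : 0 < a) (ha1 : a ≠ 1) :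
    ∃ C : ℝ, ∀ N x : ℝ, 0 < N →
      ‖∫ t in N..(2 * N), Complex.exp (Complex.I * ((x * t - t ^ a : ℝ) : ℂ))‖
        ≤ C * N ^ (1 - a / 2) := by
  -- The linear term `x * t` disappears from the second derivative, so the bound is uniform in `x`;
  -- `a ≠ 1` makes `c` positive.
  set c : ℝ := |a * (a - 1)| * 2 ^ (-|a - 2|) with hc
  have hc0 : 0 < c := by
    have : a * (a - 1) ≠ 0 := mul_ne_zero ha.ne' (sub_ne_zero.2 ha1)
    positivity
  refine ⟨8 / √c, fun N x hN => ?_⟩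
  have hl : 0 < c * N ^ (a - 2) := by positivity
  have e : 8 / √c * N ^ (1 - a / 2) = 8 / √(c * N ^ (a - 2)) := by
    rw [Real.sqrt_mul hc0.le, Real.sqrt_eq_rpow (N ^ (a - 2)), ← Real.rpow_mul hN.le,
      show (1 - a / 2) = -((a - 2) * (1 / 2)) by ring, Real.rpow_neg hN.le]
    field_simp
  have hp : ∀ t ∈ Icc N (2 * N), 0 < t := fun t ht => hN.trans_le ht.1
  have hφ : ∀ t ∈ Icc N (2 * N),
      HasDerivAt (fun t : ℝ => x * t - t ^ a) (x - a * t ^ (a - 1)) t := fun t ht => by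
    simpa using ((hasDerivAt_id t).const_mul x).fun_sub
      (Real.hasDerivAt_rpow_const (p := a) (Or.inl (hp t ht).ne'))
  have hu : ∀ t ∈ Icc N (2 * N),
      HasDerivAt (fun t : ℝ => x - a * t ^ (a - 1)) (-(a * (a - 1)) * t ^ (a - 2)) t :=
    fun t ht => by
      have := ((Real.hasDerivAt_rpow_const (p := a - 1) (Or.inl (hp t ht).ne')).const_mul
        a).const_sub x
      refine this.congr_deriv ?_
      rw [show a - 1 - 1 = a - 2 by ring]
      ring
  have hu' : ContinuousOn (fun t : ℝ => -(a * (a - 1)) * t ^ (a - 2)) (Icc N (2 * N)) :=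
    continuousOn_const.mul (continuousOn_id.rpow_const fun t ht => Or.inl (hp t ht).ne')
  rw [e]
  have hb : ∀ t ∈ Icc N (2 * N), c * N ^ (a - 2) ≤ |a * (a - 1)| * t ^ (a - 2) := fun t ht => by
    rw [hc, mul_assoc]
    gcongr
    exact rpow_ge_of_mem_dyadic _ hN ht
  rcases lt_or_gt_of_ne ha1 with h | h
  · refine norm_integral_exp_I_le_of_le_deriv (by linarith) hl hφ hu hu' fun t ht => ?_
    have := hb t ht
    rwa [abs_of_neg (mul_neg_of_pos_of_neg ha (by linarith))] at this
  · refine norm_integral_exp_I_le_of_deriv_le (by linarith) hl hφ hu hu' fun t ht => ?_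
    have := hb t ht
    rw [abs_of_pos (mul_pos ha (by linarith))] at this
    linarith

/-! ### The oscillating function lies outside `A(ℝ)`. -/

theorem continuous_abs_rpow {a : ℝ} (ha : 0 < a) : Continuous fun t : ℝ => |t| ^ a :=
  continuous_abs.rpow_const fun _ => Or.inr ha.le

theorem not_memFourierA_oscillating {a b : ℝ} (ha : 0 < a) (ha1 : a ≠ 1) (hb : 0 < b)
    (hab : 4 * b < a) : ¬ MemFourierA (oscillating a b) := by
  rintro ⟨g, hg, hrep⟩
  obtain ⟨C, hC⟩ := exists_norm_integral_exp_rpow_le ha ha1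
  have hac := continuous_abs_rpow ha
  -- Both sides bound the integral of `(1 + t²)^{-b}` over `[N, 2N]`. The lower one uses `1 + t² ≤ 5
  -- N²`; the upper one uses Fubini and van der Corput.
  have key : ∀ N : ℝ, 1 ≤ N →
      5 ^ (-b) * N ^ (1 - 2 * b) ≤ (∫ x, ‖g x‖) * (C * N ^ (1 - a / 2)) := by
    intro N hN
    have hN0 : 0 < N := by linarith
    have hN2 : N ≤ 2 * N := by linarith
    have e1 : ∀ t ∈ Ioc N (2 * N), (((1 + t ^ 2) ^ (-b) : ℝ) : ℂ)
        = ∫ x, g x * Complex.exp (Complex.I * ((x * t - |t| ^ a : ℝ) : ℂ)) := by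
      intro t ht
      have h1 : (((1 + t ^ 2) ^ (-b) : ℝ) : ℂ)
          = oscillating a b t * Complex.exp (-(Complex.I * ((|t| ^ a : ℝ) : ℂ))) := by
        rw [oscillating, div_mul_eq_mul_div, ← Complex.exp_add, add_neg_cancel, Complex.exp_zero,
          Real.rpow_neg (by positivity), Complex.ofReal_inv, one_div]
      rw [h1, hrep, ← integral_mul_const]
      refine integral_congr_ae (Eventually.of_forall fun x => ?_)
      simp only
      rw [mul_assoc, ← Complex.exp_add]
      congr 2
      push_cast
      ring
    have hint : Integrable (fun p : ℝ × ℝ =>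
        g p.2 * Complex.exp (Complex.I * ((p.2 * p.1 - |p.1| ^ a : ℝ) : ℂ)))
        ((volume.restrict (Ioc N (2 * N))).prod volume) := by
      have h1 : Integrable (fun p : ℝ × ℝ => g p.2)
          ((volume.restrict (Ioc N (2 * N))).prod volume) := hg.comp_snd _
      refine h1.norm.mono' (h1.1.mul (Continuous.aestronglyMeasurable ?_))
        (Eventually.of_forall fun p => ?_)
      · have := hac.comp (continuous_fst (X := ℝ) (Y := ℝ))
        simp only [Function.comp_def] at this
        fun_prop
      · rw [norm_mul_exp_I_mul]
    have e2 : ∫ t in Ioc N (2 * N), (((1 + t ^ 2) ^ (-b) : ℝ) : ℂ)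
        = ∫ x, g x * ∫ t in N..(2 * N), Complex.exp (Complex.I * ((x * t - t ^ a : ℝ) : ℂ)) := by
      rw [setIntegral_congr_fun measurableSet_Ioc e1, integral_integral_swap hint]
      refine integral_congr_ae (Eventually.of_forall fun x => ?_)
      simp only
      rw [integral_const_mul, intervalIntegral.integral_of_le hN2]
      congr 1
      refine setIntegral_congr_fun measurableSet_Ioc fun t ht => ?_
      rw [abs_of_pos (hN0.trans ht.1)]
    have hup : ‖∫ t in Ioc N (2 * N), (((1 + t ^ 2) ^ (-b) : ℝ) : ℂ)‖
        ≤ (∫ x, ‖g x‖) * (C * N ^ (1 - a / 2)) := by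
      rw [e2, ← integral_mul_const]
      refine norm_integral_le_of_norm_le (hg.norm.mul_const _) (Eventually.of_forall fun x => ?_)
      rw [norm_mul]
      gcongr
      exact hC N x hN0
    refine le_trans ?_ hup
    rw [integral_complex_ofReal, Complex.norm_real]
    refine le_trans ?_ (le_abs_self _)
    have hcont : Continuous fun t : ℝ => (1 + t ^ 2) ^ (-b) :=
      (continuous_const.add (continuous_pow 2)).rpow_const fun t =>
        Or.inl (show (0 : ℝ) < 1 + t ^ 2 by positivity).ne'
    have hlow : ∀ t ∈ Ioc N (2 * N), 5 ^ (-b) * N ^ (-(2 * b)) ≤ (1 + t ^ 2) ^ (-b) := by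
      intro t ht
      have e3 : (5 : ℝ) ^ (-b) * N ^ (-(2 * b)) = (5 * N ^ 2) ^ (-b) := by
        rw [Real.mul_rpow (by norm_num) (by positivity), ← Real.rpow_natCast_mul hN0.le]
        congr 2
        push_cast
        ring
      rw [e3]
      have ht0 := hN0.trans ht.1
      exact Real.rpow_le_rpow_of_nonpos (by positivity) (by nlinarith [ht.2]) (by linarith)
    calc 5 ^ (-b) * N ^ (1 - 2 * b) = ∫ _ in Ioc N (2 * N), 5 ^ (-b) * N ^ (-(2 * b)) := by
          rw [setIntegral_const, Real.volume_real_Ioc_of_le hN2, smul_eq_mul,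
            sub_eq_add_neg (1 : ℝ), Real.rpow_add hN0, Real.rpow_one]
          ring
      _ ≤ _ := setIntegral_mono_on (integrableOn_const (by simp))
          (hcont.integrableOn_Ioc) measurableSet_Ioc hlow
  have hlim : Tendsto (fun N : ℝ => N ^ (a / 2 - 2 * b)) atTop atTop :=
    tendsto_rpow_atTop (by linarith)
  obtain ⟨N, hN, hN1⟩ := ((hlim.eventually_gt_atTop
    (5 ^ b * ((∫ x, ‖g x‖) * C))).and (eventually_ge_atTop 1)).exists
  have hN0 : 0 < N := by linarith
  have h := key N hN1
  have e : N ^ (1 - 2 * b) = N ^ (a / 2 - 2 * b) * N ^ (1 - a / 2) := by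
    rw [← Real.rpow_add hN0]; congr 1; ring
  rw [e, ← mul_assoc, ← mul_assoc] at h
  have h2 := le_of_mul_le_mul_right h (by positivity)
  rw [Real.rpow_neg (by norm_num), inv_mul_le_iff₀ (by positivity)] at h2
  linarith

/-! ### The oscillating function satisfies the decay hypotheses. -/

theorem norm_oscillating (a b t : ℝ) : ‖oscillating a b t‖ = (1 + t ^ 2) ^ (-b) := by
  rw [oscillating, norm_div, mul_comm Complex.I, Complex.norm_exp_ofReal_mul_I, Complex.norm_real,
    Real.norm_of_nonneg (by positivity), Real.rpow_neg (by positivity), one_div]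

theorem continuous_one_add_sq_rpow (b : ℝ) : Continuous fun t : ℝ => (1 + t ^ 2) ^ b :=
  (continuous_const.add (continuous_pow 2)).rpow_const fun t =>
    Or.inl (show (0 : ℝ) < 1 + t ^ 2 by positivity).ne'

theorem oscillating_eq_mul (a b : ℝ) : oscillating a b = fun t : ℝ =>
    Complex.exp (Complex.I * ((|t| ^ a : ℝ) : ℂ)) * (((1 + t ^ 2) ^ (-b) : ℝ) : ℂ) := by
  ext t
  rw [oscillating, Real.rpow_neg (by positivity), Complex.ofReal_inv, div_eq_mul_inv]

theorem continuous_oscillating {a : ℝ} (ha : 0 < a) (b : ℝ) : Continuous (oscillating a b) := by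
  rw [oscillating_eq_mul]
  exact (continuous_const.mul (Complex.continuous_ofReal.comp (continuous_abs_rpow ha))).cexp.mul
    (Complex.continuous_ofReal.comp (continuous_one_add_sq_rpow (-b)))

theorem contDiffAt_oscillating (a b : ℝ) {t : ℝ} (ht : t ≠ 0) :
    ContDiffAt ℝ 1 (oscillating a b) t := by
  have h1 : ContDiffAt ℝ 1 (fun t : ℝ => |t| ^ a) t :=
    (contDiffAt_abs ht).rpow_const_of_ne (abs_ne_zero.2 ht)
  have h2 : ContDiffAt ℝ 1 (fun t : ℝ => (1 + t ^ 2) ^ (-b)) t :=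
    ContDiffAt.rpow_const_of_ne (by fun_prop) (by positivity)
  rw [oscillating_eq_mul]
  exact (contDiffAt_const.mul (Complex.ofRealCLM.contDiff.contDiffAt.comp t h1)).cexp.mul
    (Complex.ofRealCLM.contDiff.contDiffAt.comp t h2)

theorem one_add_sq_rpow_neg_le_abs {b t : ℝ} (hb : 0 ≤ b) (ht : t ≠ 0) :
    (1 + t ^ 2) ^ (-b) ≤ |t| ^ (-(2 * b)) := by
  have h0 : 0 < |t| := abs_pos.2 ht
  have e : |t| ^ (-(2 * b)) = (t ^ 2) ^ (-b) := by
    rw [← sq_abs, ← Real.rpow_natCast_mul h0.le]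
    congr 1
    push_cast
    ring
  rw [e]
  exact Real.rpow_le_rpow_of_nonpos (by positivity) (by linarith) (by linarith)

theorem norm_deriv_oscillating_le_of_pos {a b t : ℝ} (ha : 0 < a) (hb : 0 < b) (ht : 0 < t) :
    ‖deriv (oscillating a b) t‖
      ≤ (a * t ^ (a - 1) + 2 * b * t / (1 + t ^ 2)) * (1 + t ^ 2) ^ (-b) := by
  have hq : (0 : ℝ) < 1 + t ^ 2 := by positivity
  have h1 := (((Real.hasDerivAt_rpow_const (p := a) (Or.inl ht.ne')).ofReal_comp).const_mul
    Complex.I).cexp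
  have h2 := ((((hasDerivAt_id t).fun_pow 2).const_add 1).rpow_const (p := -b)
    (Or.inl hq.ne')).ofReal_comp
  have h3 : HasDerivAt (oscillating a b) _ t := (h1.mul h2).congr_of_eventuallyEq (by
    filter_upwards [eventually_gt_nhds ht] with s hs
    simp only [oscillating_eq_mul, abs_of_pos hs, Pi.mul_apply, id])
  rw [h3.deriv]
  refine (norm_add_le _ _).trans ?_
  simp only [norm_mul, mul_comm Complex.I (_ : ℂ), Complex.norm_exp_ofReal_mul_I, Complex.norm_I,
    Complex.norm_real, id, one_mul, mul_one, Real.norm_eq_abs]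
  rw [add_mul]
  refine add_le_add (le_of_eq ?_) (le_of_eq ?_)
  · rw [abs_of_pos ha, abs_of_pos (show 0 < t ^ (a - 1) by positivity),
      abs_of_pos (show 0 < (1 + t ^ 2) ^ (-b) by positivity)]
  · simp only [Nat.cast_ofNat, Nat.add_one_sub_one, pow_one, abs_neg, abs_two,
      abs_of_pos hb, abs_of_pos ht]
    rw [abs_of_pos (by positivity), Real.rpow_sub_one hq.ne']
    field_simp

theorem norm_deriv_oscillating_le {a b t : ℝ} (ha : 0 < a) (hb : 0 < b) (ht : t ≠ 0) :
    ‖deriv (oscillating a b) t‖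
      ≤ (a * |t| ^ (a - 1) + 2 * b * |t| / (1 + t ^ 2)) * (1 + t ^ 2) ^ (-b) := by
  rcases lt_or_gt_of_ne ht with h | h
  · have e : (fun s => oscillating a b (-s)) = oscillating a b := by
      ext s; simp [oscillating]
    have h1 := deriv_comp_neg (oscillating a b) t
    rw [e] at h1
    have h2 := norm_deriv_oscillating_le_of_pos ha hb (neg_pos.2 h)
    rw [h1, norm_neg, abs_of_neg h]
    rwa [neg_sq] at h2
  · rw [abs_of_pos h]
    exact norm_deriv_oscillating_le_of_pos ha hb h

theorem eventually_one_le_abs : ∀ᶠ t : ℝ in cocompact ℝ, 1 ≤ |t| :=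
  (tendsto_norm_cocompact_atTop (E := ℝ)).eventually_ge_atTop 1

theorem derivMajorant_oscillating_le {a b R t : ℝ} (ha : 0 < a) (hb : 0 < b) (ht : 0 < t) :
    derivMajorant (oscillating a b) R t
      ≤ ENNReal.ofReal (a * t ^ (a - 1) + (a * |R| ^ (a - 1) + 2 * b)) := by
  have hm : MeasurableSet {s : ℝ | t ≤ |s| ∧ |s| ≤ R} :=
    (measurableSet_le measurable_const measurable_norm).inter
      (measurableSet_le measurable_norm measurable_const)
  refine essSup_le_of_ae_le _ ((ae_restrict_iff' hm).2 (Eventually.of_forall fun s hs => ?_))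
  change ‖deriv (oscillating a b) s‖ₑ ≤ _
  rw [← ofReal_norm]
  refine ENNReal.ofReal_le_ofReal ?_
  have hs0 : 0 < |s| := ht.trans_le hs.1
  have hR : |s| ≤ |R| := hs.2.trans (le_abs_self R)
  refine (norm_deriv_oscillating_le ha hb (abs_pos.1 hs0)).trans ?_
  have h1 : (1 + s ^ 2) ^ (-b) ≤ (1 : ℝ) :=
    Real.rpow_le_one_of_one_le_of_nonpos (by linarith [sq_nonneg s]) (by linarith)
  have h2 : |s| / (1 + s ^ 2) ≤ 1 := by
    rw [div_le_one (by positivity), ← sq_abs]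
    nlinarith [sq_nonneg (|s| - 1)]
  -- The power is monotone in a direction that depends on the sign of `a - 1`; the sum of the two
  -- endpoint values covers both cases.
  have h3 : |s| ^ (a - 1) ≤ t ^ (a - 1) + |R| ^ (a - 1) := by
    have p1 : 0 ≤ t ^ (a - 1) := by positivity
    have p2 : 0 ≤ |R| ^ (a - 1) := by positivity
    rcases le_total 0 (a - 1) with h | h
    · linarith [Real.rpow_le_rpow hs0.le hR h]
    · linarith [Real.rpow_le_rpow_of_nonpos ht hs.1 h]
  have h4 : a * |s| ^ (a - 1) ≤ a * (t ^ (a - 1) + |R| ^ (a - 1)) := by gcongr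
  have h5 : 2 * b * |s| / (1 + s ^ 2) ≤ 2 * b := by
    rw [mul_div_assoc]; nlinarith
  calc _ ≤ (a * |s| ^ (a - 1) + 2 * b * |s| / (1 + s ^ 2)) * 1 := by gcongr
    _ ≤ _ := by linarith

theorem A1_oscillating_lt_top {a b : ℝ} (ha : 0 < a) (hb : 0 < b) (R : ℝ) :
    A1 (oscillating a b) R < ⊤ := by
  set c := a * |R| ^ (a - 1) + 2 * b with hc
  have hc0 : 0 < c := by positivity
  -- On `(0, 1]` the power `t ^ (γ - 1)` dominates both `t ^ (a - 1)` and `1`. The logarithm costs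
  -- only `t ^ (-γ / 2)`, which leaves an integrable power.
  set γ := min a 1 with hγ
  have hγ0 : 0 < γ := lt_min ha one_pos
  set K := (a + c) * (2 ^ (γ / 2) / (γ / 2)) with hK
  have hint : IntegrableOn (fun t : ℝ => K * t ^ (γ / 2 - 1)) (Ioc 0 1) :=
    (((intervalIntegral.intervalIntegrable_rpow' (a := 0) (b := 1)
      (show -1 < γ / 2 - 1 by linarith))).1).const_mul K
  refine lt_of_le_of_lt ?_ hint.lintegral_lt_top
  refine setLIntegral_mono' measurableSet_Ioc fun t ht => ?_
  have ht0 := ht.1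
  have hlog0 : 0 ≤ Real.log (2 / t) := Real.log_nonneg ((one_le_div ht0).2 (by linarith [ht.2]))
  refine (mul_le_mul_left (derivMajorant_oscillating_le ha hb ht0) _).trans ?_
  rw [← ENNReal.ofReal_mul (by positivity)]
  refine ENNReal.ofReal_le_ofReal ?_
  have h1 : t ^ (a - 1) ≤ t ^ (γ - 1) :=
    Real.rpow_le_rpow_of_exponent_ge ht0 ht.2 (by linarith [min_le_left a 1])
  have h2 : 1 ≤ t ^ (γ - 1) :=
    Real.one_le_rpow_of_pos_of_le_one_of_nonpos ht0 ht.2 (by linarith [min_le_right a 1])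
  have h3 : Real.log (2 / t) ≤ (2 / t) ^ (γ / 2) / (γ / 2) :=
    Real.log_le_rpow_div (by positivity) (by positivity)
  calc (a * t ^ (a - 1) + c) * Real.log (2 / t)
      ≤ (a * t ^ (γ - 1) + c * t ^ (γ - 1)) * ((2 / t) ^ (γ / 2) / (γ / 2)) := by
        gcongr
        nlinarith
    _ = K * t ^ (γ / 2 - 1) := by
        rw [Real.div_rpow (by norm_num) ht0.le, hK,
          show γ - 1 = (γ / 2 - 1) + γ / 2 by ring, Real.rpow_add ht0]
        field_simp

/-- At infinity the derivative of the phase dominates, so `f'` has order `|t| ^ (a - 1 - 2b)`. -/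
theorem decayHypotheses_oscillating {a b α β : ℝ} (ha : 0 < a) (hα : 0 < α) (hb : 2 * b = α)
    (hβ : a - 1 - α ≤ -β) : DecayHypotheses (oscillating a b) α β := by
  have hb0 : 0 < b := by linarith
  have hO : oscillating a b =O[cocompact ℝ] fun t : ℝ => |t| ^ (-α) := by
    refine IsBigO.of_bound 1 ?_
    filter_upwards [eventually_one_le_abs] with t ht
    rw [norm_oscillating, one_mul, Real.norm_of_nonneg (by positivity), ← hb]
    exact one_add_sq_rpow_neg_le_abs hb0.le (abs_pos.1 (by linarith))
  refine ⟨⟨continuous_oscillating ha b, ?_⟩, ?_, A1_oscillating_lt_top ha hb0, hO, ?_⟩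
  · exact hO.trans_tendsto
      ((tendsto_rpow_neg_atTop hα).comp (tendsto_norm_cocompact_atTop (E := ℝ)))
  · intro x y hxy h0
    refine ContDiffOn.absolutelyContinuousOnInterval fun t ht => ?_
    rw [uIcc_of_le hxy] at ht
    exact (contDiffAt_oscillating a b fun h => h0 (h ▸ ht)).contDiffWithinAt
  · refine IsBigO.mono (IsBigO.of_bound (a + 2 * b) ?_) inf_le_left
    filter_upwards [eventually_one_le_abs] with t ht
    have ht0 : 0 < |t| := by linarith
    rw [Real.norm_of_nonneg (by positivity)]
    refine (norm_deriv_oscillating_le ha hb0 (abs_pos.1 ht0)).trans ?_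
    have h1 : |t| / (1 + t ^ 2) ≤ |t| ^ (a - 1) := by
      calc |t| / (1 + t ^ 2) ≤ |t| ^ (-1 : ℝ) := by
            rw [Real.rpow_neg_one, div_le_iff₀ (by positivity), ← sq_abs]
            field_simp
            linarith
        _ ≤ _ := Real.rpow_le_rpow_of_exponent_le ht (by linarith)
    have h2 := one_add_sq_rpow_neg_le_abs hb0.le (abs_pos.1 ht0)
    calc _ ≤ (a * |t| ^ (a - 1) + 2 * b * |t| ^ (a - 1)) * |t| ^ (-(2 * b)) := by
          rw [mul_div_assoc]
          gcongr
      _ = (a + 2 * b) * |t| ^ (a - 1 - α) := by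
          rw [← hb, sub_eq_add_neg (a - 1), Real.rpow_add ht0]
          ring
      _ ≤ _ := by gcongr

theorem exists_oscillation_exponent {x y : ℝ} (h : x < y) : ∃ a, x < a ∧ a ≤ y ∧ a ≠ 1 := by
  by_cases hy : y = 1
  · obtain ⟨a, h1, h2⟩ := exists_between h
    exact ⟨a, h1, h2.le, by rw [← hy]; exact h2.ne⟩
  · exact ⟨y, h, le_rfl, hy⟩

theorem corollary1p2 :
    (∀ (f : ℝ → ℂ) (α β : ℝ), 0 < α → 1 < α + β → DecayHypotheses f α β → MemFourierA f) ∧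
    (∀ α β : ℝ, 0 < α → α + β < 1 →
      ∃ α₁ β₁ : ℝ, 0 < α₁ ∧ 0 < β₁ ∧
        DecayHypotheses (oscillating α₁ β₁) α β ∧ ¬ MemFourierA (oscillating α₁ β₁)) := by
  refine ⟨fun f α β hα hαβ h => h.memFourierA hα hαβ, fun α β hα hαβ => ?_⟩
  -- With `β₁ = α / 2`, leaving `A(ℝ)` needs `a > 4β₁ = 2α`, and the decay of the derivative needs
  -- `a ≤ 1 + α - β`. This window is nonempty exactly when `α + β < 1`, and `a = 1`, a linear phase,
  -- can be avoided in it.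
  obtain ⟨a, h1, h2, h3⟩ := exists_oscillation_exponent (show 2 * α < 1 + α - β by linarith)
  have ha : 0 < a := by linarith
  exact ⟨a, α / 2, ha, by linarith,
    decayHypotheses_oscillating ha hα (by ring) (by linarith),
    not_memFourierA_oscillating ha h3 (by linarith) (by linarith)⟩
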